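/- Let $d\ge 1$, $n\ge 2$ be integers. Let $A\in\mathbb R^{n\times d}$ be a random matrix with independent Gaussian entries, each with standard deviation $\sigma$, where $0<\sigma\le \frac{1}{4\sqrt{d\ln n}}$, and suppose that every row of $\mathbb E[A]$ has Euclidean norm at most $1$. Let $c,c'\in\mathbb R^d$ and $b\in\mathbb R^n$ be fixed, where either at most $d$ coordinates of $b$ are zero or some coordinate of $b$ is negative. Let $Z\in\mathbb R^d$ be a random vector, independent of $A$, with a probability density $\mu>0$ that is $1$-log-Lipschitz, i.e. $|\ln\mu(x)-\ln\mu(y)|\le\|x-y\|$ for all $x,y\in\mathbb R^d$. Notation. For $I\subseteq[n]$ with $|I|=d$, let $A_I$ and $b_I$ consist of the rows of $A$ and the entries of $b$ indexed by $I$; when $A_I$ is invertible put $x_I=A_I^{-1}b_I$. For vectors $u,u'\in\mathbb R^d$ and reals $g,m$: - $F(A,b)$ is the set of feasible bases: those $I$ with $A_I$ invertible and $Ax_I\le b$. - $G(A,b,g)$ is the set of $I\in F(A,b)$ with $a_j^\top x_I\le b_j-g\|x_I\|$ for all $j\in[n]\setminus I$, where $a_j^\top$ is the $j$-th row of $A$.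 - $M(A,u,u',m)$ is the set of $I$ with $A_I$ invertible for which some $y$ on the segment $[u,u']$ satisfies $y^\top A_I^{-1}\ge m$ coordinatewise. - $P(A,b,u,u')$, the shadow path, is the set of $I\in F(A,b)$ for which $[u,u']$ meets the cone generated by the rows of $A_I$. Regard $P(A,b,u,u')$ as a graph in which $I$ and $I'$ are adjacent if and only if the segment between the distinct points $\pi(x_I)$ and $\pi(x_{I'})$ is an edge of the shadow polygon $\pi(\{x: Ax\le b\})$, where $\pi$ is the orthogonal projection onto $\operatorname{span}(u,u')$. For a set $S$ of vertices of this graph, $T^S$ denotes the set of those vertices in $S$ that have at least two neighbours in $S$. Then, with $g=\dfrac{\sigma}{5000\,d^{3/2}\ln(n)^{3/2}}$ and $m=\dfrac{\ln(1/0.99)}{2d}$, $$\mathbb E\big[|P(A,b,c+Z,c'+Z)|\big]\;\le\; 500+2\,\mathbb E\Big[\big|T^{\,G(A,b,g)\,\cap\, M(A,c+Z,c'+Z,m)}\big|\Big],$$ where $T$ is taken in the graph on the shadow path $P(A,b,c+Z,c'+Z)$. -/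

import Mathlib

open MeasureTheory ProbabilityTheory
open scoped ENNReal Matrix

namespace ShadowPath

noncomputable section

/-- The `d`-element subsets of `[n]`, i.e. the candidate bases of a system of `n` inequalities
in `d` variables. -/
abbrev IndexSet (n d : ℕ) : Type := {I : Finset (Fin n) // I.card = d}

/-- The `d × d` matrix `A_I` whose rows are the rows of `A` with index in `I`
(listed in increasing order). -/
def subMatrix {n d : ℕ} (A : Matrix (Fin n) (Fin d) ℝ) (I : IndexSet n d) :
    Matrix (Fin d) (Fin d) ℝ :=
  A.submatrix (I.1.orderEmbOfFin I.2) id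

/-- The subvector `b_I`, listed in the same order as the rows of `A_I`. -/
def subVector {n d : ℕ} (b : Fin n → ℝ) (I : IndexSet n d) : Fin d → ℝ :=
  fun k => b (I.1.orderEmbOfFin I.2 k)

/-- The basic solution `x_I = A_I⁻¹ b_I`. -/
def basicSolution {n d : ℕ} (A : Matrix (Fin n) (Fin d) ℝ) (b : Fin n → ℝ) (I : IndexSet n d) :
    EuclideanSpace ℝ (Fin d) :=
  WithLp.toLp 2 ((subMatrix A I)⁻¹ *ᵥ subVector b I)

/-- The polyhedron `{x : A x ≤ b}`. -/
def polyhedron {n d : ℕ} (A : Matrix (Fin n) (Fin d) ℝ) (b : Fin n → ℝ) :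
    Set (EuclideanSpace ℝ (Fin d)) :=
  {x | ∀ j, (A *ᵥ x.ofLp) j ≤ b j}

/-- `F(A, b)`: the feasible bases, i.e. those `I` with `A_I` invertible and `A x_I ≤ b`. -/
def feasibleBases {n d : ℕ} (A : Matrix (Fin n) (Fin d) ℝ) (b : Fin n → ℝ) :
    Set (IndexSet n d) :=
  {I | IsUnit (subMatrix A I) ∧ basicSolution A b I ∈ polyhedron A b}

/-- `G(A, b, g)`: the feasible bases with relative gap `g`, i.e. those feasible `I` with
`a_jᵀ x_I ≤ b_j - g ‖x_I‖` for all `j ∉ I`. -/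
def gapBases {n d : ℕ} (A : Matrix (Fin n) (Fin d) ℝ) (b : Fin n → ℝ) (g : ℝ) :
    Set (IndexSet n d) :=
  {I | I ∈ feasibleBases A b ∧
    ∀ j, j ∉ I.1 → (A *ᵥ (basicSolution A b I).ofLp) j ≤ b j - g * ‖basicSolution A b I‖}

/-- `M(A, c, c', m)`: the bases with good multipliers, i.e. those `I` with `A_I` invertible for
which some `y ∈ [c, c']` satisfies `yᵀ A_I⁻¹ ≥ m` coordinatewise. -/
def multiplierBases {n d : ℕ} (A : Matrix (Fin n) (Fin d) ℝ) (c c' : EuclideanSpace ℝ (Fin d))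
    (m : ℝ) : Set (IndexSet n d) :=
  {I | IsUnit (subMatrix A I) ∧
    ∃ y ∈ segment ℝ c c', ∀ k, m ≤ (y.ofLp ᵥ* (subMatrix A I)⁻¹) k}

/-- The cone generated by the rows of `A` with index in `I`. -/
def rowCone {n d : ℕ} (A : Matrix (Fin n) (Fin d) ℝ) (I : IndexSet n d) :
    Set (EuclideanSpace ℝ (Fin d)) :=
  {y | ∃ w : Fin d → ℝ, (∀ k, 0 ≤ w k) ∧ y.ofLp = w ᵥ* subMatrix A I}

/-- `P(A, b, c, c')`: the shadow path, i.e. the feasible bases `I` such that the segment `[c, c']`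
meets the cone generated by the rows of `A_I`. -/
def shadowPath {n d : ℕ} (A : Matrix (Fin n) (Fin d) ℝ) (b : Fin n → ℝ)
    (c c' : EuclideanSpace ℝ (Fin d)) : Set (IndexSet n d) :=
  {I | I ∈ feasibleBases A b ∧ (segment ℝ c c' ∩ rowCone A I).Nonempty}

/-- The orthogonal projection `π_{c,c'}` onto `span(c, c')`. -/
def shadowProj {d : ℕ} (c c' : EuclideanSpace ℝ (Fin d)) :
    EuclideanSpace ℝ (Fin d) →L[ℝ] EuclideanSpace ℝ (Fin d) :=
  (Submodule.span ℝ {c, c'}).starProjection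

/-- The shadow polygon `π_{c,c'}({x : A x ≤ b})`. -/
def shadowPolygon {n d : ℕ} (A : Matrix (Fin n) (Fin d) ℝ) (b : Fin n → ℝ)
    (c c' : EuclideanSpace ℝ (Fin d)) : Set (EuclideanSpace ℝ (Fin d)) :=
  shadowProj c c' '' polyhedron A b

/-- The segment between the distinct points `p` and `q` is an edge of `S`, i.e. a
one-dimensional face (for polyhedra, faces and exposed faces are the same). -/
def IsEdgeBetween {E : Type*} [NormedAddCommGroup E] [NormedSpace ℝ E] (S : Set E) (p q : E) :
    Prop :=
  p ≠ q ∧ IsExposed ℝ S (segment ℝ p q)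

/-- The shadow path as a graph: two bases on the path are adjacent iff the shadow polygon has an
edge between the projections of their basic solutions. Index sets that are not on the path are
isolated. -/
def shadowGraph {n d : ℕ} (A : Matrix (Fin n) (Fin d) ℝ) (b : Fin n → ℝ)
    (c c' : EuclideanSpace ℝ (Fin d)) : SimpleGraph (IndexSet n d) where
  Adj I J := I ∈ shadowPath A b c c' ∧ J ∈ shadowPath A b c c' ∧
    IsEdgeBetween (shadowPolygon A b c c')
      (shadowProj c c' (basicSolution A b I)) (shadowProj c c' (basicSolution A b J))
  symm := ⟨fun I J h => ⟨h.2.1, h.1, h.2.2.1.symm, by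
    rw [segment_symm]
    exact h.2.2.2⟩⟩
  loopless := ⟨fun I h => h.2.2.1 rfl⟩

/-- `T^S`: the vertices in `S` that have at least two neighbours in `S`. -/
def triples {V : Type*} (G : SimpleGraph V) (S : Set V) : Set V :=
  {v | v ∈ S ∧ 2 ≤ (G.neighborSet v ∩ S).encard}

/-- `f` is a positive function whose logarithm is `L`-Lipschitz. -/
def IsLogLipschitz {E : Type*} [NormedAddCommGroup E] (L : ℝ) (f : E → ℝ) : Prop :=
  (∀ x, 0 < f x) ∧ ∀ x y, |Real.log (f x) - Real.log (f y)| ≤ L * ‖x - y‖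

end

end ShadowPath

namespace ShadowPath

noncomputable section

variable {n d : ℕ} {A : Matrix (Fin n) (Fin d) ℝ} {b : Fin n → ℝ}

/-! ### Basic solutions, multipliers and edge directions of a basis -/

/-! The proof combines a deterministic count with two conditional probability estimates.

Deterministic part. Suppose that only basis constraints are tight at feasible bases
(`Nondegenerate`), and that along the segment of objectives no two multipliers of a basis vanish
together and none vanishes at an endpoint (`GenericSegment`). A basis on the path is optimal on a
nondegenerate interval of parameters, and when its interval ends a simplex pivot leads to the next
basis (`exists_rightNbr`). "Next" is an injective partial function, at most one basis has no
successor and at most one has no predecessor. So a basis on the path that is not in `T^S` is an end,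
lies outside `S`, or is next to a basis of the path outside `S`. This gives `|P| ≤ |T^S| + 2 + 3 |P
\ S|` for every `S` (`ncard_shadowPath_le`). Both general-position assumptions hold almost surely
(`ae_nondegenerate`, `ae_genericSegment`).

Probabilistic part, for one basis `I`, with `L = d ln n`. Gap: condition on `Z` and on the rows in
`I`. Then `x_I` is fixed, the other rows are independent Gaussians, and feasibility has probability
`∏ Φ(θ_j)`. Asking for the gap `g = σh` replaces each `θ_j` by `θ_j - h`, which costs at most a
tenth of the product plus `e^{-L}` (`prod_gaussianCdf_sub_le`). Multipliers: condition on `A` and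
suppose that all rows have norm at most `2`. Moving `Z` by `m` times the sum of the rows in `I`
raises each multiplier by `m`. The move has length at most `2dm = ln(1/0.99)`, so by
log-Lipschitzness at most one percent of the probability is lost
(`shiftLaw_multiplierBases_diff_le`). Long rows have probability at most `e^{-L}`
(`matrixLaw_long_row_le`).

There are at most `n^d = e^L` candidate bases, so summation gives `E|P \ S| ≤ 0.11 E|P| + 2`
(`lintegral_ncard_shadowPath_diff_le`). With the count, `0.67 E|P| ≤ 8 + E|T^S|`, which is stronger
than the claim. -/

theorem mem_iff_exists_orderEmbOfFin (I : IndexSet n d) {j : Fin n} :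
    j ∈ I.1 ↔ ∃ k, I.1.orderEmbOfFin I.2 k = j := by
  have h := Finset.range_orderEmbOfFin I.1 I.2
  rw [← Finset.mem_coe, ← h, Set.mem_range]

theorem subMatrix_mulVec (A : Matrix (Fin n) (Fin d) ℝ) (I : IndexSet n d) (x : Fin d → ℝ)
    (k : Fin d) : (subMatrix A I *ᵥ x) k = (A *ᵥ x) (I.1.orderEmbOfFin I.2 k) := rfl

theorem isUnit_subMatrix_of_forall {I : IndexSet n d}
    (h : ∀ x : Fin d → ℝ, (∀ j ∈ I.1, (A *ᵥ x) j = 0) → x = 0) : IsUnit (subMatrix A I) := by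
  rw [← Matrix.mulVec_injective_iff_isUnit]
  refine (injective_iff_map_eq_zero (Matrix.mulVecLin (subMatrix A I))).2 fun x hx => h x ?_
  intro j hj
  obtain ⟨k, rfl⟩ := (mem_iff_exists_orderEmbOfFin I).1 hj
  exact congrFun hx k

theorem mulVec_basicSolution {I : IndexSet n d} (hI : IsUnit (subMatrix A I)) {j : Fin n}
    (hj : j ∈ I.1) : (A *ᵥ (basicSolution A b I).ofLp) j = b j := by
  obtain ⟨k, rfl⟩ := (mem_iff_exists_orderEmbOfFin I).1 hj
  rw [← subMatrix_mulVec]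
  simp only [basicSolution, Matrix.mulVec_mulVec]
  rw [Matrix.mul_nonsing_inv _ ((Matrix.isUnit_iff_isUnit_det _).1 hI), Matrix.one_mulVec]
  rfl

theorem ext_of_mulVec_eq {I : IndexSet n d} (hI : IsUnit (subMatrix A I)) {x x' : Fin d → ℝ}
    (h : ∀ j ∈ I.1, (A *ᵥ x) j = (A *ᵥ x') j) : x = x' := by
  apply Matrix.mulVec_injective_iff_isUnit.2 hI
  ext k
  rw [subMatrix_mulVec, subMatrix_mulVec]
  exact h _ ((mem_iff_exists_orderEmbOfFin I).2 ⟨k, rfl⟩)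

theorem eq_basicSolution {I : IndexSet n d} (hI : IsUnit (subMatrix A I)) {x : Fin d → ℝ}
    (h : ∀ j ∈ I.1, (A *ᵥ x) j = b j) : x = (basicSolution A b I).ofLp :=
  ext_of_mulVec_eq hI fun j hj => (h j hj).trans (mulVec_basicSolution hI hj).symm

/-- The multipliers `yᵀ A_I⁻¹`, indexed by all rows and extended by zero outside `I`. -/
def multipliers (A : Matrix (Fin n) (Fin d) ℝ) (I : IndexSet n d) (y : Fin d → ℝ) : Fin n → ℝ :=
  Function.extend (I.1.orderEmbOfFin I.2) (y ᵥ* (subMatrix A I)⁻¹) 0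

theorem multipliers_orderEmbOfFin (A : Matrix (Fin n) (Fin d) ℝ) (I : IndexSet n d)
    (y : Fin d → ℝ) (k : Fin d) :
    multipliers A I y (I.1.orderEmbOfFin I.2 k) = (y ᵥ* (subMatrix A I)⁻¹) k :=
  (I.1.orderEmbOfFin I.2).injective.extend_apply _ _ _

theorem multipliers_of_notMem {I : IndexSet n d} {j : Fin n} (hj : j ∉ I.1) (y : Fin d → ℝ) :
    multipliers A I y j = 0 :=
  Function.extend_apply' _ _ _ fun h => hj ((mem_iff_exists_orderEmbOfFin I).2 h)

theorem multipliers_nonneg_iff {I : IndexSet n d} {y : Fin d → ℝ} :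
    (∀ j, 0 ≤ multipliers A I y j) ↔ ∀ k, 0 ≤ (y ᵥ* (subMatrix A I)⁻¹) k := by
  refine ⟨fun h k => multipliers_orderEmbOfFin A I y k ▸ h _, fun h j => ?_⟩
  by_cases hj : j ∈ I.1
  · obtain ⟨k, rfl⟩ := (mem_iff_exists_orderEmbOfFin I).1 hj
    exact (multipliers_orderEmbOfFin A I y k).symm ▸ h k
  · exact (multipliers_of_notMem hj y).ge

theorem multipliers_add (I : IndexSet n d) (y y' : Fin d → ℝ) (j : Fin n) :
    multipliers A I (y + y') j = multipliers A I y j + multipliers A I y' j := by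
  by_cases hj : j ∈ I.1
  · obtain ⟨k, rfl⟩ := (mem_iff_exists_orderEmbOfFin I).1 hj
    simp only [multipliers_orderEmbOfFin, Matrix.add_vecMul, Pi.add_apply]
  · simp only [multipliers_of_notMem hj, add_zero]

theorem multipliers_smul (I : IndexSet n d) (t : ℝ) (y : Fin d → ℝ) (j : Fin n) :
    multipliers A I (t • y) j = t * multipliers A I y j := by
  by_cases hj : j ∈ I.1
  · obtain ⟨k, rfl⟩ := (mem_iff_exists_orderEmbOfFin I).1 hj
    simp only [multipliers_orderEmbOfFin, Matrix.smul_vecMul, Pi.smul_apply, smul_eq_mul]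
  · simp only [multipliers_of_notMem hj, mul_zero]

theorem multipliers_vecMul {I : IndexSet n d} (hI : IsUnit (subMatrix A I)) (y : Fin d → ℝ) :
    multipliers A I y ᵥ* A = y := by
  have h : (y ᵥ* (subMatrix A I)⁻¹) ᵥ* subMatrix A I = y := by
    rw [Matrix.vecMul_vecMul, Matrix.nonsing_inv_mul _ ((Matrix.isUnit_iff_isUnit_det _).1 hI),
      Matrix.vecMul_one]
  ext c
  rw [← congrFun h c]
  symm
  refine Fintype.sum_of_injective _ (I.1.orderEmbOfFin I.2).injective _ _ (fun j hj => ?_)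
    fun k => ?_
  · rw [multipliers_of_notMem fun h => hj ((mem_iff_exists_orderEmbOfFin I).1 h), zero_mul]
  · rw [multipliers_orderEmbOfFin]
    rfl

/-- The rows of an invertible `A_I` are linearly independent. At a pivot this identifies the
multipliers of the old and the new basis. -/
theorem eq_multipliers {I : IndexSet n d} (hI : IsUnit (subMatrix A I)) {w : Fin n → ℝ}
    (hw : ∀ j ∉ I.1, w j = 0) : w = multipliers A I (w ᵥ* A) := by
  have h : (w ∘ I.1.orderEmbOfFin I.2) ᵥ* subMatrix A I = w ᵥ* A := by
    ext c
    refine Fintype.sum_of_injective _ (I.1.orderEmbOfFin I.2).injective _ _ (fun j hj => ?_)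
      fun k => rfl
    rw [hw j fun h => hj ((mem_iff_exists_orderEmbOfFin I).1 h), zero_mul]
  ext j
  by_cases hj : j ∈ I.1
  · obtain ⟨k, rfl⟩ := (mem_iff_exists_orderEmbOfFin I).1 hj
    rw [multipliers_orderEmbOfFin, ← h, Matrix.vecMul_vecMul,
      Matrix.mul_nonsing_inv _ ((Matrix.isUnit_iff_isUnit_det _).1 hI), Matrix.vecMul_one]
    rfl
  · rw [hw j hj, multipliers_of_notMem hj]

theorem dotProduct_eq_sum_multipliers {I : IndexSet n d} (hI : IsUnit (subMatrix A I))
    (y x : Fin d → ℝ) : y ⬝ᵥ x = ∑ j, multipliers A I y j * (A *ᵥ x) j := by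
  conv_lhs => rw [← multipliers_vecMul hI y, ← Matrix.dotProduct_mulVec]
  rfl

/-- The direction of the edge that leaves the basic solution of `I` when the constraint `i ∈ I`
is relaxed. -/
def edgeDir (A : Matrix (Fin n) (Fin d) ℝ) (I : IndexSet n d) (i : Fin n) : Fin d → ℝ :=
  (subMatrix A I)⁻¹ *ᵥ fun k => if I.1.orderEmbOfFin I.2 k = i then -1 else 0

theorem mulVec_edgeDir {I : IndexSet n d} (hI : IsUnit (subMatrix A I)) {i j : Fin n}
    (hj : j ∈ I.1) : (A *ᵥ edgeDir A I i) j = if j = i then -1 else 0 := by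
  obtain ⟨k, rfl⟩ := (mem_iff_exists_orderEmbOfFin I).1 hj
  rw [← subMatrix_mulVec, edgeDir, Matrix.mulVec_mulVec,
    Matrix.mul_nonsing_inv _ ((Matrix.isUnit_iff_isUnit_det _).1 hI), Matrix.one_mulVec]

theorem dotProduct_edgeDir {I : IndexSet n d} (hI : IsUnit (subMatrix A I)) (y : Fin d → ℝ)
    {i : Fin n} (hi : i ∈ I.1) : y ⬝ᵥ edgeDir A I i = -multipliers A I y i := by
  rw [dotProduct_eq_sum_multipliers hI, Finset.sum_eq_single i]
  · rw [mulVec_edgeDir hI hi, if_pos rfl, mul_neg_one]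
  · intro j _ hji
    by_cases hj : j ∈ I.1
    · rw [mulVec_edgeDir hI hj, if_neg hji, mul_zero]
    · rw [multipliers_of_notMem hj, zero_mul]
  · exact fun h => absurd (Finset.mem_univ i) h

theorem eq_basicSolution_add_smul_edgeDir {I : IndexSet n d} (hI : IsUnit (subMatrix A I))
    {i : Fin n} {x : Fin d → ℝ} (h : ∀ j ∈ I.1, j ≠ i → (A *ᵥ x) j = b j) :
    x = (basicSolution A b I).ofLp + (b i - (A *ᵥ x) i) • edgeDir A I i := by
  refine ext_of_mulVec_eq hI fun j hj => ?_
  rw [Matrix.mulVec_add, Matrix.mulVec_smul, Pi.add_apply, Pi.smul_apply,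
    mulVec_basicSolution hI hj, mulVec_edgeDir hI hj]
  split_ifs with hji
  · subst hji
    simp
  · simp [h j hj hji]

/-! ### Optimality -/

theorem dotProduct_le_of_multipliers_nonneg {I : IndexSet n d} (hI : IsUnit (subMatrix A I))
    {y x : Fin d → ℝ} (hy : ∀ j, 0 ≤ multipliers A I y j) (hx : ∀ j, (A *ᵥ x) j ≤ b j) :
    y ⬝ᵥ x ≤ y ⬝ᵥ (basicSolution A b I).ofLp := by
  rw [dotProduct_eq_sum_multipliers hI, dotProduct_eq_sum_multipliers hI]
  refine Finset.sum_le_sum fun j _ => ?_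
  by_cases hj : j ∈ I.1
  · rw [mulVec_basicSolution hI hj]
    exact mul_le_mul_of_nonneg_left (hx j) (hy j)
  · simp [multipliers_of_notMem hj]

theorem mulVec_eq_of_dotProduct_ge {I : IndexSet n d} (hI : IsUnit (subMatrix A I))
    {y x : Fin d → ℝ} (hy : ∀ j, 0 ≤ multipliers A I y j) (hx : ∀ j, (A *ᵥ x) j ≤ b j)
    (h : y ⬝ᵥ (basicSolution A b I).ofLp ≤ y ⬝ᵥ x) {j : Fin n} (hj : multipliers A I y j ≠ 0) :
    (A *ᵥ x) j = b j := by
  rw [dotProduct_eq_sum_multipliers hI, dotProduct_eq_sum_multipliers hI] at h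
  have hle : ∀ k ∈ Finset.univ, multipliers A I y k * (A *ᵥ x) k ≤
      multipliers A I y k * (A *ᵥ (basicSolution A b I).ofLp) k := by
    intro k _
    by_cases hk : k ∈ I.1
    · rw [mulVec_basicSolution hI hk]
      exact mul_le_mul_of_nonneg_left (hx k) (hy k)
    · simp [multipliers_of_notMem hk]
  have := (Finset.sum_eq_sum_iff_of_le hle).1 (le_antisymm (Finset.sum_le_sum hle) h) j
    (Finset.mem_univ j)
  have hjI : j ∈ I.1 := by
    by_contra hjI
    exact hj (multipliers_of_notMem hjI y)
  rw [mulVec_basicSolution hI hjI] at this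
  exact mul_left_cancel₀ hj this

/-- Every feasible basis is nondegenerate: only the constraints in the basis are tight. -/
def Nondegenerate (A : Matrix (Fin n) (Fin d) ℝ) (b : Fin n → ℝ) : Prop :=
  ∀ I ∈ feasibleBases A b, ∀ j ∉ I.1, (A *ᵥ (basicSolution A b I).ofLp) j < b j

theorem Nondegenerate.eq_of_subset_tight (h : Nondegenerate A b) {I J : IndexSet n d}
    (hI : I ∈ feasibleBases A b)
    (hJ : ∀ j ∈ J.1, (A *ᵥ (basicSolution A b I).ofLp) j = b j) : J = I := by
  have : J.1 ⊆ I.1 := fun j hj => by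
    by_contra hjI
    exact (h I hI j hjI).ne (hJ j hj)
  exact Subtype.ext (Finset.eq_of_subset_of_card_le this (by rw [I.2, J.2]))

theorem Nondegenerate.basicSolution_inj (h : Nondegenerate A b) {I J : IndexSet n d}
    (hI : I ∈ feasibleBases A b) (hJ : J ∈ feasibleBases A b)
    (heq : (basicSolution A b I).ofLp = (basicSolution A b J).ofLp) : I = J :=
  (h.eq_of_subset_tight hI fun j hj => by rw [heq, mulVec_basicSolution hJ.1 hj]).symm

/-- No two multipliers of `y` with respect to a basis vanish. -/
def IsGeneric (A : Matrix (Fin n) (Fin d) ℝ) (y : Fin d → ℝ) : Prop :=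
  ∀ I : IndexSet n d, IsUnit (subMatrix A I) → ∀ i ∈ I.1, ∀ k ∈ I.1, i ≠ k →
    multipliers A I y i = 0 → multipliers A I y k ≠ 0

/-- No multiplier of `y` with respect to a basis vanishes. -/
def IsRegular (A : Matrix (Fin n) (Fin d) ℝ) (y : Fin d → ℝ) : Prop :=
  ∀ I : IndexSet n d, IsUnit (subMatrix A I) → ∀ i ∈ I.1, multipliers A I y i ≠ 0

/-- The points of the optimal face of a basis with a vanishing multiplier lie on an edge. -/
theorem eq_add_smul_edgeDir_of_dotProduct_ge {I : IndexSet n d} (hI : IsUnit (subMatrix A I))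
    {y x : Fin d → ℝ} (hy : ∀ j, 0 ≤ multipliers A I y j) (hx : ∀ j, (A *ᵥ x) j ≤ b j)
    (h : y ⬝ᵥ (basicSolution A b I).ofLp ≤ y ⬝ᵥ x) {i : Fin n}
    (hi : ∀ k ∈ I.1, k ≠ i → multipliers A I y k ≠ 0) :
    ∃ t : ℝ, 0 ≤ t ∧ x = (basicSolution A b I).ofLp + t • edgeDir A I i :=
  ⟨_, sub_nonneg.2 (hx i), eq_basicSolution_add_smul_edgeDir hI fun k hk hki =>
    mulVec_eq_of_dotProduct_ge hI hy hx h (hi k hk hki)⟩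

theorem IsGeneric.exists_forall_ne_zero {y : Fin d → ℝ} (hg : IsGeneric A y) (hd : 1 ≤ d)
    {I : IndexSet n d} (hI : IsUnit (subMatrix A I)) :
    ∃ q, ∀ k ∈ I.1, k ≠ q → multipliers A I y k ≠ 0 := by
  by_cases h : ∃ q ∈ I.1, multipliers A I y q = 0
  · obtain ⟨q, hq, hq0⟩ := h
    exact ⟨q, fun k hk hkq => hg I hI q hq k hk hkq.symm hq0⟩
  · push Not at h
    have : I.1.Nonempty := by
      rw [← Finset.card_pos, I.2]
      exact hd
    obtain ⟨q, -⟩ := this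
    exact ⟨q, fun k hk _ => h k hk⟩

/-- At most two feasible bases are optimal for a generic objective. -/
theorem not_three_optimal (hd : 1 ≤ d) (hA : Nondegenerate A b) {y : Fin d → ℝ}
    (hg : IsGeneric A y) {u v w : IndexSet n d} (hu : u ∈ feasibleBases A b)
    (hv : v ∈ feasibleBases A b) (hw : w ∈ feasibleBases A b)
    (hyu : ∀ j, 0 ≤ multipliers A u y j) (hyv : ∀ j, 0 ≤ multipliers A v y j)
    (hyw : ∀ j, 0 ≤ multipliers A w y j) (huv : u ≠ v) (huw : u ≠ w) (hvw : v ≠ w) : False := by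
  obtain ⟨q, hq⟩ := hg.exists_forall_ne_zero hd hw.1
  obtain ⟨s, hs, hxu⟩ := eq_add_smul_edgeDir_of_dotProduct_ge hw.1 hyw hu.2
    (dotProduct_le_of_multipliers_nonneg hu.1 hyu hw.2) hq
  obtain ⟨t, ht, hxv⟩ := eq_add_smul_edgeDir_of_dotProduct_ge hw.1 hyw hv.2
    (dotProduct_le_of_multipliers_nonneg hv.1 hyv hw.2) hq
  have key : ∀ u v : IndexSet n d, u ∈ feasibleBases A b → v ∈ feasibleBases A b → u ≠ v →
      u ≠ w → ∀ s t : ℝ, 0 ≤ s →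
      (basicSolution A b u).ofLp = (basicSolution A b w).ofLp + s • edgeDir A w q →
      (basicSolution A b v).ofLp = (basicSolution A b w).ofLp + t • edgeDir A w q →
      s ≤ t → False := by
    intro u v hu hv huv huw s t hs hxu hxv hst
    rcases hst.eq_or_lt with rfl | hst
    · exact huv (hA.basicSolution_inj hu hv (hxu.trans hxv.symm))
    refine huw (hA.eq_of_subset_tight hw fun j hj => ?_)
    have h1 := mulVec_basicSolution (b := b) hu.1 hj
    have h2 := hv.2 j
    have h3 := hw.2 j
    rw [hxu, Matrix.mulVec_add, Matrix.mulVec_smul, Pi.add_apply, Pi.smul_apply,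
      smul_eq_mul] at h1
    rw [hxv, Matrix.mulVec_add, Matrix.mulVec_smul, Pi.add_apply, Pi.smul_apply,
      smul_eq_mul] at h2
    -- The slack of row `j` is affine along the ray, nonnegative at parameters `0` and `t`, and zero
    -- at `s < t`. If it were positive at `0` it would be negative at `t`.
    refine le_antisymm h3 ?_
    by_contra hlt
    push Not at hlt
    have h4 : 0 < s * (A *ᵥ edgeDir A w q) j := by linarith
    have h5 : 0 < (A *ᵥ edgeDir A w q) j := by
      by_contra h
      push Not at h
      nlinarith
    nlinarith
  rcases le_total s t with h | h
  · exact key u v hu hv huv huw s t hs hxu hxv h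
  · exact key v u hv hu huv.symm hvw t s ht hxv hxu h

end

noncomputable section

variable {n d : ℕ} {A : Matrix (Fin n) (Fin d) ℝ} {b : Fin n → ℝ}

/-! ### Pivots along the shadow path -/

/-- The objective at parameter `t` of the segment from `c` to `c'`. -/
abbrev objective (c c' : EuclideanSpace ℝ (Fin d)) (t : ℝ) : Fin d → ℝ :=
  (AffineMap.lineMap c c' t : EuclideanSpace ℝ (Fin d)).ofLp

/-- The basis `I` is dual feasible for the objective at parameter `t`. -/
def DualFeasible (A : Matrix (Fin n) (Fin d) ℝ) (c c' : EuclideanSpace ℝ (Fin d))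
    (I : IndexSet n d) (t : ℝ) : Prop :=
  ∀ j, 0 ≤ multipliers A I (objective c c' t) j

variable {c c' : EuclideanSpace ℝ (Fin d)}

theorem multipliers_objective (I : IndexSet n d) (t : ℝ) (j : Fin n) :
    multipliers A I (objective c c' t) j =
      multipliers A I c.ofLp j + t * multipliers A I (c' - c).ofLp j := by
  have : objective c c' t = t • (c' - c).ofLp + c.ofLp := by
    simp [objective, AffineMap.lineMap_apply]
  rw [this, multipliers_add, multipliers_smul, add_comm]

theorem multipliers_objective_sub (I : IndexSet n d) (r t : ℝ) (j : Fin n) :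
    multipliers A I (objective c c' t) j =
      multipliers A I (objective c c' r) j + (t - r) * multipliers A I (c' - c).ofLp j := by
  rw [multipliers_objective, multipliers_objective I r]
  ring

theorem mem_rowCone_iff {I : IndexSet n d} (hI : IsUnit (subMatrix A I))
    {y : EuclideanSpace ℝ (Fin d)} :
    y ∈ rowCone A I ↔ ∀ k, 0 ≤ (y.ofLp ᵥ* (subMatrix A I)⁻¹) k := by
  have hdet := (Matrix.isUnit_iff_isUnit_det _).1 hI
  constructor
  · rintro ⟨w, hw, h⟩
    rwa [h, Matrix.vecMul_vecMul, Matrix.mul_nonsing_inv _ hdet, Matrix.vecMul_one]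
  · intro h
    refine ⟨_, h, ?_⟩
    rw [Matrix.vecMul_vecMul, Matrix.nonsing_inv_mul _ hdet, Matrix.vecMul_one]

theorem mem_shadowPath_iff {I : IndexSet n d} :
    I ∈ shadowPath A b c c' ↔
      I ∈ feasibleBases A b ∧ ∃ t ∈ Set.Icc (0 : ℝ) 1, DualFeasible A c c' I t := by
  refine and_congr_right fun hI => ?_
  constructor
  · rintro ⟨y, hy, hyI⟩
    rw [segment_eq_image_lineMap] at hy
    obtain ⟨t, ht, rfl⟩ := hy
    exact ⟨t, ht, multipliers_nonneg_iff.2 ((mem_rowCone_iff hI.1).1 hyI)⟩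
  · rintro ⟨t, ht, h⟩
    refine ⟨AffineMap.lineMap c c' t, ?_, (mem_rowCone_iff hI.1).2 (multipliers_nonneg_iff.1 h)⟩
    rw [segment_eq_image_lineMap]
    exact ⟨t, ht, rfl⟩

theorem shadowProj_symm : shadowProj c c' = shadowProj c' c := by
  simp only [shadowProj, Set.pair_comm]

theorem shadowGraph_symm : shadowGraph A b c c' = shadowGraph A b c' c := by
  ext I J
  simp only [shadowGraph, shadowPath, shadowPolygon, segment_symm ℝ c c', shadowProj_symm (c := c)]

theorem dualFeasible_symm {I : IndexSet n d} {t : ℝ} :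
    DualFeasible A c' c I t ↔ DualFeasible A c c' I (1 - t) := by
  simp only [DualFeasible, objective, AffineMap.lineMap_apply_one_sub]

/-- `w` follows `v` on the shadow path when it is traversed from `c` to `c'`. -/
def RightNbr (A : Matrix (Fin n) (Fin d) ℝ) (b : Fin n → ℝ) (c c' : EuclideanSpace ℝ (Fin d))
    (v w : IndexSet n d) : Prop :=
  v ∈ feasibleBases A b ∧ w ∈ feasibleBases A b ∧ (shadowGraph A b c c').Adj v w ∧
    ∃ r ∈ Set.Icc (0 : ℝ) 1, DualFeasible A c c' v r ∧ DualFeasible A c c' w r ∧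
      (∀ t ∈ Set.Icc (0 : ℝ) 1, DualFeasible A c c' v t → t ≤ r) ∧
      ∀ t ∈ Set.Icc (0 : ℝ) 1, DualFeasible A c c' w t → r ≤ t

theorem RightNbr.symm {v w : IndexSet n d} (h : RightNbr A b c c' v w) :
    RightNbr A b c' c w v := by
  obtain ⟨hv, hw, hadj, r, hr, hvr, hwr, hv', hw'⟩ := h
  have hmem : ∀ {t : ℝ}, t ∈ Set.Icc (0 : ℝ) 1 → 1 - t ∈ Set.Icc (0 : ℝ) 1 := fun ht =>
    ⟨sub_nonneg.2 ht.2, sub_le_self _ ht.1⟩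
  refine ⟨hw, hv, ?_, 1 - r, hmem hr, ?_, ?_, fun t ht h => ?_, fun t ht h => ?_⟩
  · rw [shadowGraph_symm]
    exact hadj.symm
  · rwa [dualFeasible_symm, sub_sub_cancel]
  · rwa [dualFeasible_symm, sub_sub_cancel]
  · have := hw' _ (hmem ht) (dualFeasible_symm.1 h)
    linarith
  · have := hv' _ (hmem ht) (dualFeasible_symm.1 h)
    linarith

/-- The segment of objectives is in general position with respect to the bases. -/
def GenericSegment (A : Matrix (Fin n) (Fin d) ℝ) (c c' : EuclideanSpace ℝ (Fin d)) : Prop :=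
  (∀ t, IsGeneric A (objective c c' t)) ∧ IsRegular A c.ofLp ∧ IsRegular A c'.ofLp

theorem GenericSegment.symm (h : GenericSegment A c c') : GenericSegment A c' c := by
  refine ⟨fun t => ?_, h.2.2, h.2.1⟩
  rw [← sub_sub_cancel 1 t, objective, AffineMap.lineMap_apply_one_sub]
  exact h.1 _

/-- Both pivots take place at the least parameter at which `w` is optimal, so two different
predecessors would make three bases optimal there. -/
theorem RightNbr.left_unique (hd : 1 ≤ d) (hA : Nondegenerate A b) (hg : GenericSegment A c c')
    {v v' w : IndexSet n d} (h : RightNbr A b c c' v w) (h' : RightNbr A b c c' v' w) :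
    v = v' := by
  obtain ⟨hv, hw, hadj, r, hr, hvr, hwr, -, hw'⟩ := h
  obtain ⟨hv', -, hadj', r', hr', hvr', hwr', -, hw''⟩ := h'
  obtain rfl : r = r' := le_antisymm (hw' _ hr' hwr') (hw'' _ hr hwr)
  by_contra hne
  exact not_three_optimal hd hA (hg.1 r) hv hv' hw hvr hvr' hwr hne hadj.ne hadj'.ne

theorem RightNbr.right_unique (hd : 1 ≤ d) (hA : Nondegenerate A b) (hg : GenericSegment A c c')
    {v w w' : IndexSet n d} (h : RightNbr A b c c' v w) (h' : RightNbr A b c c' v w') :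
    w = w' :=
  h.symm.left_unique hd hA hg.symm h'.symm

/-- The parameters at which a basis on the path is optimal form a nondegenerate interval. -/
theorem exists_dualFeasible_ne (hd : 1 ≤ d) (hg : GenericSegment A c c') {v : IndexSet n d}
    (hv : IsUnit (subMatrix A v)) {r : ℝ} (hr : r ∈ Set.Icc (0 : ℝ) 1)
    (hvr : DualFeasible A c c' v r) :
    ∃ t ∈ Set.Icc (0 : ℝ) 1, t ≠ r ∧ DualFeasible A c c' v t := by
  obtain ⟨q, hq⟩ := (hg.1 r).exists_forall_ne_zero hd hv
  have hcont : ∀ j, Continuous fun t => multipliers A v (objective c c' t) j := fun j => by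
    simp only [multipliers_objective]
    fun_prop
  have hev : ∀ j, j ≠ q → ∀ᶠ t in nhds r, 0 ≤ multipliers A v (objective c c' t) j := by
    intro j hjq
    by_cases hj : j ∈ v.1
    · have := (hvr j).lt_of_ne' (hq j hj hjq)
      filter_upwards [(hcont j).continuousAt.eventually (lt_mem_nhds this)] with t ht using ht.le
    · exact Filter.Eventually.of_forall fun t => (multipliers_of_notMem hj _).ge
  have hev' : ∀ᶠ t in nhds r, ∀ j, j ≠ q → 0 ≤ multipliers A v (objective c c' t) j :=
    Filter.eventually_all.2 fun j => by
      by_cases h : j = q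
      · exact Filter.Eventually.of_forall fun t h' => absurd h h'
      · filter_upwards [hev j h] with t ht _ using ht
  -- All multipliers except possibly the one of `q` stay nonnegative near `r`. The remaining one is
  -- affine in the parameter, so moving in the direction in which it does not decrease is safe.
  have hright : r < 1 → 0 ≤ multipliers A v (c' - c).ofLp q →
      ∃ t ∈ Set.Icc (0 : ℝ) 1, t ≠ r ∧ DualFeasible A c c' v t := by
    intro hr1 hs
    obtain ⟨t, ht, h1, h2⟩ := ((hev'.filter_mono nhdsWithin_le_nhds).and
      (Ioo_mem_nhdsGT hr1)).exists
    refine ⟨t, ⟨hr.1.trans h1.le, h2.le⟩, h1.ne', fun j => ?_⟩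
    by_cases hj : j = q
    · subst hj
      rw [multipliers_objective_sub v r]
      exact add_nonneg (hvr j) (mul_nonneg (sub_nonneg.2 h1.le) hs)
    · exact ht j hj
  have hleft : 0 < r → multipliers A v (c' - c).ofLp q ≤ 0 →
      ∃ t ∈ Set.Icc (0 : ℝ) 1, t ≠ r ∧ DualFeasible A c c' v t := by
    intro hr1 hs
    obtain ⟨t, ht, h1, h2⟩ := ((hev'.filter_mono nhdsWithin_le_nhds).and
      (Ioo_mem_nhdsLT hr1)).exists
    refine ⟨t, ⟨h1.le, h2.le.trans hr.2⟩, h2.ne, fun j => ?_⟩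
    by_cases hj : j = q
    · subst hj
      rw [multipliers_objective_sub v r]
      exact add_nonneg (hvr j) (mul_nonneg_of_nonpos_of_nonpos (sub_nonpos.2 h2.le) hs)
    · exact ht j hj
  rcases le_total 0 (multipliers A v (c' - c).ofLp q) with hs | hs
  · rcases hr.2.lt_or_eq with hr1 | rfl
    -- If the safe direction leaves `[0, 1]`, then `r` is an endpoint. There regularity makes the
    -- multiplier of `q ∈ v` positive, so the opposite direction also works.
    · exact hright hr1 hs
    · by_cases hqv : q ∈ v.1
      · have hpos : 0 < multipliers A v (objective c c' 1) q := by
          refine (hvr q).lt_of_ne' ?_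
          simpa [objective] using hg.2.2 v hv q hqv
        obtain ⟨t, ⟨ht, h3⟩, h1, h2⟩ := (((hev'.and ((hcont q).continuousAt.eventually
          (lt_mem_nhds hpos))).filter_mono nhdsWithin_le_nhds).and
          (Ioo_mem_nhdsLT (zero_lt_one (α := ℝ)))).exists
        refine ⟨t, ⟨h1.le, h2.le⟩, h2.ne, fun j => ?_⟩
        by_cases hj : j = q
        · subst hj
          exact h3.le
        · exact ht j hj
      · exact hleft one_pos (multipliers_of_notMem hqv _).le
  · rcases hr.1.lt_or_eq with hr1 | rfl
    · exact hleft hr1 hs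
    · by_cases hqv : q ∈ v.1
      · have hpos : 0 < multipliers A v (objective c c' 0) q := by
          refine (hvr q).lt_of_ne' ?_
          simpa [objective] using hg.2.1 v hv q hqv
        obtain ⟨t, ⟨ht, h3⟩, h1, h2⟩ := (((hev'.and ((hcont q).continuousAt.eventually
          (lt_mem_nhds hpos))).filter_mono nhdsWithin_le_nhds).and
          (Ioo_mem_nhdsGT (zero_lt_one (α := ℝ)))).exists
        refine ⟨t, ⟨h1.le, h2.le⟩, h1.ne', fun j => ?_⟩
        by_cases hj : j = q
        · subst hj
          exact h3.le
        · exact ht j hj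
      · exact hright one_pos (multipliers_of_notMem hqv _).ge

/-- Both relations together would force `v` to be optimal at one parameter only. -/
theorem RightNbr.asymm (hd : 1 ≤ d) (hg : GenericSegment A c c') {v w : IndexSet n d}
    (h : RightNbr A b c c' v w) (h' : RightNbr A b c c' w v) : False := by
  obtain ⟨hv, hw, -, r, hr, hvr, hwr, hv1, hw1⟩ := h
  obtain ⟨-, -, -, s, hs, hws, hvs, hw2, hv2⟩ := h'
  obtain ⟨t, ht, htr, hvt⟩ := exists_dualFeasible_ne hd hg hv.1 hr hvr
  have h1 := hv1 t ht hvt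
  have h2 := hv2 t ht hvt
  have h3 := hw2 r hr hwr
  exact htr (le_antisymm h1 (h3.trans h2))

/-- The projection is self-adjoint and fixes `y`. Objectives on the segment therefore take the same
values on the polyhedron and on its shadow. -/
theorem inner_shadowProj {y : EuclideanSpace ℝ (Fin d)} (hy : y ∈ segment ℝ c c')
    (x : EuclideanSpace ℝ (Fin d)) : inner ℝ y (shadowProj c c' x) = y.ofLp ⬝ᵥ x.ofLp := by
  have hy' : y ∈ Submodule.span ℝ {c, c'} :=
    (Submodule.span ℝ {c, c'}).convex.segment_subset (Submodule.subset_span (by simp))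
      (Submodule.subset_span (by simp)) hy
  rw [shadowProj, ← Submodule.inner_starProjection_left_eq_right,
    Submodule.starProjection_eq_self_iff.2 hy', EuclideanSpace.inner_eq_star_dotProduct,
    dotProduct_comm]
  simp

theorem objective_mem_segment {t : ℝ} (ht : t ∈ Set.Icc (0 : ℝ) 1) :
    (AffineMap.lineMap c c' t : EuclideanSpace ℝ (Fin d)) ∈ segment ℝ c c' := by
  rw [segment_eq_image_lineMap]
  exact ⟨t, ht, rfl⟩

end

/-! ### Existence of pivots and the order of the shadow path -/

noncomputable section

variable {n d : ℕ} {A : Matrix (Fin n) (Fin d) ℝ} {b : Fin n → ℝ}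
variable {c c' : EuclideanSpace ℝ (Fin d)}

/-- Exchanging `i` for `j` in a basis. -/
theorem exists_exchange (v : IndexSet n d) {i j : Fin n} (hi : i ∈ v.1) (hj : j ∉ v.1) :
    ∃ w : IndexSet n d, ∀ k, k ∈ w.1 ↔ k = j ∨ k ∈ v.1 ∧ k ≠ i := by
  refine ⟨⟨insert j (v.1.erase i), ?_⟩, fun k => ?_⟩
  · rw [Finset.card_insert_of_notMem fun h => hj (Finset.mem_of_mem_erase h),
      Finset.card_erase_of_mem hi, v.2]
    have : 0 < d := by
      rw [← v.2]
      exact Finset.card_pos.2 ⟨i, hi⟩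
    omega
  · simp only [Finset.mem_insert, Finset.mem_erase, and_comm]

/-- A vector annihilated by the rows common to `v` and `w` is a multiple of the edge direction, and
row `j` does not vanish on that direction. -/
theorem isUnit_subMatrix_exchange {v w : IndexSet n d} (hv : IsUnit (subMatrix A v)) {i j : Fin n}
    (hw : ∀ k, k ∈ w.1 ↔ k = j ∨ k ∈ v.1 ∧ k ≠ i)
    (hj : (A *ᵥ edgeDir A v i) j ≠ 0) : IsUnit (subMatrix A w) := by
  refine isUnit_subMatrix_of_forall fun x hx => ?_
  have h := eq_basicSolution_add_smul_edgeDir (b := 0) hv (x := x) (i := i)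
    fun k hk hki => hx k ((hw k).2 (Or.inr ⟨hk, hki⟩))
  have h0 : (basicSolution A 0 v).ofLp = 0 :=
    (eq_basicSolution hv (b := 0) (x := 0) fun k _ => by simp).symm
  rw [h0, zero_add] at h
  have hxj := hx j ((hw j).2 (Or.inl rfl))
  rw [h, Matrix.mulVec_smul, Pi.smul_apply, smul_eq_mul] at hxj
  rw [h, (mul_eq_zero.1 hxj).resolve_right hj, zero_smul]

/-- The objective at parameter `r` exposes the edge. Only the multiplier of `i` vanishes, so the
optimal points of the polyhedron lie on the ray from `x_v` along the edge direction, and row `j`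
stops that ray at `x'`. -/
theorem isEdgeBetween_of_edgeDir {v : IndexSet n d} (hv : v ∈ feasibleBases A b)
    {i : Fin n} (hi : i ∈ v.1) {r : ℝ} (hr : r ∈ Set.Icc (0 : ℝ) 1)
    (hvr : DualFeasible A c c' v r)
    (hne : ∀ k ∈ v.1, k ≠ i → multipliers A v (objective c c' r) k ≠ 0)
    (hi0 : multipliers A v (objective c c' r) i = 0) (hc' : multipliers A v c'.ofLp i ≠ 0)
    {T : ℝ} (hT : 0 < T) {x' : EuclideanSpace ℝ (Fin d)} (hx'p : x' ∈ polyhedron A b)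
    (hx' : x'.ofLp = (basicSolution A b v).ofLp + T • edgeDir A v i)
    {j : Fin n} (hj : 0 < (A *ᵥ edgeDir A v i) j) (hjx : (A *ᵥ x'.ofLp) j = b j) :
    IsEdgeBetween (shadowPolygon A b c c')
      (shadowProj c c' (basicSolution A b v)) (shadowProj c c' x') := by
  have hval : ∀ y : Fin d → ℝ,
      y ⬝ᵥ x'.ofLp = y ⬝ᵥ (basicSolution A b v).ofLp - T * multipliers A v y i := by
    intro y
    rw [hx', dotProduct_add, dotProduct_smul, dotProduct_edgeDir hv.1 y hi, smul_eq_mul]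
    ring
  refine ⟨fun heq => ?_, fun _ => ⟨innerSL ℝ (AffineMap.lineMap c c' r), ?_⟩⟩
  -- The objective `c'` separates the two projections, because its multiplier at `i` is nonzero.
  · have h := congrArg (inner ℝ c') heq
    rw [inner_shadowProj (right_mem_segment ℝ c c'), inner_shadowProj (right_mem_segment ℝ c c'),
      hval] at h
    have : T * multipliers A v c'.ofLp i = 0 := by linarith
    exact (mul_ne_zero hT.ne' hc') this
  · have hopt : ∀ x ∈ polyhedron A b, objective c c' r ⬝ᵥ x.ofLp ≤
        objective c c' r ⬝ᵥ (basicSolution A b v).ofLp := fun x hx =>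
      dotProduct_le_of_multipliers_nonneg hv.1 hvr hx
    have hseg := objective_mem_segment (c := c) (c' := c') hr
    have himg : segment ℝ (shadowProj c c' (basicSolution A b v)) (shadowProj c c' x') =
        shadowProj c c' '' segment ℝ (basicSolution A b v) x' :=
      (image_segment ℝ (shadowProj c c').toLinearMap.toAffineMap _ _).symm
    rw [himg]
    have hconv : Convex ℝ (polyhedron A b) := by
      intro x hx z hz s t hs ht hst k
      have : (A *ᵥ (s • x + t • z).ofLp) k = s * (A *ᵥ x.ofLp) k + t * (A *ᵥ z.ofLp) k := by
        rw [WithLp.ofLp_add, WithLp.ofLp_smul, WithLp.ofLp_smul, Matrix.mulVec_add,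
          Matrix.mulVec_smul, Matrix.mulVec_smul]
        rfl
      rw [this]
      calc s * (A *ᵥ x.ofLp) k + t * (A *ᵥ z.ofLp) k ≤ s * b k + t * b k :=
            add_le_add (mul_le_mul_of_nonneg_left (hx k) hs) (mul_le_mul_of_nonneg_left (hz k) ht)
        _ = b k := by rw [← add_mul, hst, one_mul]
    ext z
    constructor
    · rintro ⟨x, hx, rfl⟩
      refine ⟨⟨x, hconv.segment_subset hv.2 hx'p hx, rfl⟩, ?_⟩
      rintro _ ⟨x₁, hx₁, rfl⟩
      simp only [innerSL_apply_apply]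
      rw [inner_shadowProj hseg, inner_shadowProj hseg]
      refine (hopt x₁ hx₁).trans_eq ?_
      obtain ⟨s, t, hs, ht, hst, rfl⟩ := hx
      rw [WithLp.ofLp_add, WithLp.ofLp_smul, WithLp.ofLp_smul, dotProduct_add, dotProduct_smul,
        dotProduct_smul, hval, hi0, mul_zero, sub_zero, ← add_smul, hst, one_smul]
    · rintro ⟨⟨x, hx, rfl⟩, hmax⟩
      have h := hmax _ ⟨_, hv.2, rfl⟩
      simp only [innerSL_apply_apply] at h
      rw [inner_shadowProj hseg, inner_shadowProj hseg] at h
      obtain ⟨t, ht, hxt⟩ := eq_add_smul_edgeDir_of_dotProduct_ge hv.1 hvr hx h hne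
      refine ⟨x, ?_, rfl⟩
      have htT : t ≤ T := by
        have h1 := hx j
        rw [hxt, Matrix.mulVec_add, Matrix.mulVec_smul, Pi.add_apply, Pi.smul_apply,
          smul_eq_mul] at h1
        rw [hx', Matrix.mulVec_add, Matrix.mulVec_smul, Pi.add_apply, Pi.smul_apply,
          smul_eq_mul] at hjx
        exact le_of_mul_le_mul_right (by linarith) hj
      refine ⟨1 - t / T, t / T, sub_nonneg.2 ((div_le_one hT).2 htT), div_nonneg ht hT.le,
        by ring, ?_⟩
      apply WithLp.ofLp_injective 2
      rw [WithLp.ofLp_add, WithLp.ofLp_smul, WithLp.ofLp_smul, hx', hxt, smul_add, smul_smul,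
        div_mul_cancel₀ _ hT.ne', ← add_assoc, ← add_smul, sub_add_cancel, one_smul]

theorem isClosed_dualFeasible (v : IndexSet n d) : IsClosed {t | DualFeasible A c c' v t} := by
  simp only [DualFeasible, Set.ofPred_forall]
  refine isClosed_iInter fun j => isClosed_le continuous_const ?_
  simp only [multipliers_objective]
  fun_prop

/-- One simplex pivot at the last parameter `r` at which `v` is optimal. The basis `u`, optimal at
some `s ≥ r`, shows that the path does not end at `v`: it rules out `r = 1` and an unbounded edge.
-/
theorem exists_rightNbr (hA : Nondegenerate A b) (hg : GenericSegment A c c')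
    {v u : IndexSet n d} (hv : v ∈ feasibleBases A b) (hu : u ∈ feasibleBases A b) (huv : u ≠ v)
    {r : ℝ} (hr : r ∈ Set.Icc (0 : ℝ) 1) (hvr : DualFeasible A c c' v r)
    (hmax : ∀ t ∈ Set.Icc (0 : ℝ) 1, DualFeasible A c c' v t → t ≤ r)
    {s : ℝ} (hs : s ∈ Set.Icc (0 : ℝ) 1) (hus : DualFeasible A c c' u s) (hrs : r ≤ s) :
    ∃ w, RightNbr A b c c' v w := by
  have huopt : ∀ x, (∀ j, (A *ᵥ x) j ≤ b j) → objective c c' s ⬝ᵥ x ≤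
      objective c c' s ⬝ᵥ (basicSolution A b u).ofLp := fun x hx =>
    dotProduct_le_of_multipliers_nonneg hu.1 hus hx
  rcases hr.2.eq_or_lt with rfl | hr1
  -- At `r = 1` regularity of `c'` makes all multipliers of `v` nonzero, so the optimum is unique
  -- and `u = v`.
  · obtain rfl : s = 1 := le_antisymm hs.2 hrs
    refine absurd (hA.eq_of_subset_tight hu fun j hj => ?_) huv.symm
    refine mulVec_eq_of_dotProduct_ge hv.1 hvr hu.2 (huopt _ hv.2) ?_
    simpa [objective] using hg.2.2 v hv.1 j hj
  -- The leaving row: if every vanishing multiplier had nonnegative slope, `v` would stay optimal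
  -- slightly beyond `r`.
  obtain ⟨i, hir, hslope⟩ : ∃ i, multipliers A v (objective c c' r) i ≤ 0 ∧
      multipliers A v (c' - c).ofLp i < 0 := by
    by_contra! hcon
    have hev : ∀ j, ∀ᶠ t in nhdsWithin r (Set.Ioi r),
        0 ≤ multipliers A v (objective c c' t) j := by
      intro j
      rcases le_or_gt (multipliers A v (objective c c' r) j) 0 with h | h
      · filter_upwards [self_mem_nhdsWithin] with t ht
        rw [multipliers_objective_sub v r]
        exact add_nonneg (hvr j) (mul_nonneg (sub_nonneg.2 (le_of_lt ht)) (hcon j h))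
      · have hcont : Continuous fun t => multipliers A v (objective c c' t) j := by
          simp only [multipliers_objective]
          fun_prop
        filter_upwards [(hcont.continuousAt.eventually
          (lt_mem_nhds h)).filter_mono nhdsWithin_le_nhds] with t ht using ht.le
    obtain ⟨t, ht, h1, h2⟩ := ((Filter.eventually_all.2 hev).and (Ioo_mem_nhdsGT hr1)).exists
    exact absurd (hmax t ⟨hr.1.trans h1.le, h2.le⟩ ht) (not_le.2 h1)
  have hi0 : multipliers A v (objective c c' r) i = 0 := le_antisymm hir (hvr i)
  have hi : i ∈ v.1 := by
    by_contra h
    rw [multipliers_of_notMem h] at hslope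
    exact hslope.false
  have hne : ∀ k ∈ v.1, k ≠ i → multipliers A v (objective c c' r) k ≠ 0 := fun k hk hki =>
    hg.1 r v hv.1 i hi k hk hki.symm hi0
  have hdir : ∀ t, objective c c' t ⬝ᵥ edgeDir A v i =
      (t - r) * -multipliers A v (c' - c).ofLp i := fun t => by
    rw [dotProduct_edgeDir hv.1 _ hi, multipliers_objective_sub v r, hi0]
    ring
  have hdirle : ∀ k ∈ v.1, (A *ᵥ edgeDir A v i) k ≤ 0 := fun k hk => by
    rw [mulVec_edgeDir hv.1 hk]
    split_ifs <;> norm_num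
  have hmove : ∀ (t : ℝ) (k : Fin n),
      (A *ᵥ ((basicSolution A b v).ofLp + t • edgeDir A v i)) k =
        (A *ᵥ (basicSolution A b v).ofLp) k + t * (A *ᵥ edgeDir A v i) k := fun t k => by
    rw [Matrix.mulVec_add, Matrix.mulVec_smul]
    rfl
  -- The edge is bounded. On an unbounded edge the objective at `s > r` would increase forever
  -- although `u` is optimal for it. For `s = r` the point `x_u` lies on the edge, where no row
  -- outside `v` becomes tight, so `u = v`.
  obtain ⟨j₀, hj₀⟩ : ∃ j, 0 < (A *ᵥ edgeDir A v i) j := by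
    by_contra! hcon
    have h1 : objective c c' s ⬝ᵥ edgeDir A v i ≤ 0 := by
      rw [dotProduct_eq_sum_multipliers hu.1]
      exact Finset.sum_nonpos fun j _ => mul_nonpos_of_nonneg_of_nonpos (hus j) (hcon j)
    rw [hdir] at h1
    obtain rfl : s = r := by
      refine le_antisymm (not_lt.1 fun h => ?_) hrs
      have := mul_pos (sub_pos.2 h) (neg_pos.2 hslope)
      linarith
    obtain ⟨t, ht, hxt⟩ := eq_add_smul_edgeDir_of_dotProduct_ge hv.1 hvr hu.2 (huopt _ hv.2) hne
    have hsub : u.1 ⊆ v.1 := by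
      intro j hj
      by_contra hjv
      have h2 := mulVec_basicSolution (b := b) hu.1 hj
      rw [hxt, hmove] at h2
      have h3 := hA v hv j hjv
      have h4 := mul_nonpos_of_nonneg_of_nonpos ht (hcon j)
      linarith
    exact huv (Subtype.ext (Finset.eq_of_subset_of_card_le hsub (by rw [u.2, v.2])))
  -- The ratio test: the entering row `j` is the first one to become tight along the edge, at
  -- distance `T`.
  obtain ⟨j, hj, hjmin⟩ := Finset.exists_min_image
    (Finset.univ.filter fun j => 0 < (A *ᵥ edgeDir A v i) j)
    (fun j => (b j - (A *ᵥ (basicSolution A b v).ofLp) j) / (A *ᵥ edgeDir A v i) j)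
    ⟨j₀, by simpa using hj₀⟩
  replace hj : 0 < (A *ᵥ edgeDir A v i) j := by simpa using hj
  have hjv : j ∉ v.1 := fun h => (hdirle j h).not_gt hj
  obtain ⟨T, hTdef⟩ : ∃ T, T = (b j - (A *ᵥ (basicSolution A b v).ofLp) j) /
    (A *ᵥ edgeDir A v i) j := ⟨_, rfl⟩
  have hT : 0 < T := hTdef ▸ div_pos (sub_pos.2 (hA v hv j hjv)) hj
  obtain ⟨w, hw⟩ := exists_exchange v hi hjv
  have hwU := isUnit_subMatrix_exchange hv.1 hw hj.ne'
  have hxw : (basicSolution A b v).ofLp + T • edgeDir A v i = (basicSolution A b w).ofLp := by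
    refine eq_basicSolution hwU fun k hk => ?_
    rw [hmove]
    rcases (hw k).1 hk with rfl | ⟨hkv, hki⟩
    · rw [hTdef, div_mul_cancel₀ _ hj.ne']
      ring
    · rw [mulVec_basicSolution hv.1 hkv, mulVec_edgeDir hv.1 hkv, if_neg hki]
      ring
  have hwF : w ∈ feasibleBases A b := by
    refine ⟨hwU, fun k => ?_⟩
    rw [← hxw, hmove]
    rcases le_or_gt ((A *ᵥ edgeDir A v i) k) 0 with hk | hk
    · have := mul_nonpos_of_nonneg_of_nonpos hT.le hk
      have := hv.2 k
      linarith
    · have h1 := hjmin k (by simpa using hk)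
      simp only [← hTdef] at h1
      rw [le_div_iff₀ hk] at h1
      linarith
  have hwr : DualFeasible A c c' w r := by
    -- At `r` the multiplier of `i` is zero, so the multipliers of `v` are supported on `w` and
    -- equal those of `w`.
    have h1 : multipliers A v (objective c c' r) = multipliers A w (objective c c' r) := by
      have := eq_multipliers hwU (w := multipliers A v (objective c c' r)) fun k hk => by
        by_cases hkv : k ∈ v.1
        · by_cases hki : k = i
          · rw [hki, hi0]
          · exact absurd ((hw k).2 (Or.inr ⟨hkv, hki⟩)) hk
        · exact multipliers_of_notMem hkv _
      rwa [multipliers_vecMul hv.1] at this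
    intro k
    rw [← h1]
    exact hvr k
  have hjw : j ∈ w.1 := (hw j).2 (Or.inl rfl)
  refine ⟨w, hv, hwF, ⟨mem_shadowPath_iff.2 ⟨hv, r, hr, hvr⟩,
    mem_shadowPath_iff.2 ⟨hwF, r, hr, hwr⟩, ?_⟩, r, hr, hvr, hwr, hmax, fun t ht hwt => ?_⟩
  · exact isEdgeBetween_of_edgeDir hv hi hr hvr hne hi0 (hg.2.2 v hv.1 i hi) hT hwF.2 hxw.symm hj
      (mulVec_basicSolution hwU hjw)
  -- When `w` is optimal at `t`, moving along the edge from `x_v` to `x_w` cannot lower the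
  -- objective. Its change is `T (t - r)` times a positive number.
  · have h1 := dotProduct_le_of_multipliers_nonneg hwU hwt hv.2
    rw [← hxw, dotProduct_add, dotProduct_smul, hdir, smul_eq_mul] at h1
    have h2 : 0 ≤ T * ((t - r) * -multipliers A v (c' - c).ofLp i) := by linarith
    have h3 := (mul_nonneg_iff_of_pos_left hT).1 h2
    exact sub_nonneg.1 ((mul_nonneg_iff_of_pos_right (neg_pos.2 hslope)).1 h3)

/-- Of two bases on the path, the one whose last parameter is not larger has a successor, with the
other as the witness that the path continues. -/
theorem subsingleton_not_rightNbr (hA : Nondegenerate A b) (hg : GenericSegment A c c') :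
    {v ∈ shadowPath A b c c' | ¬∃ w, RightNbr A b c c' v w}.Subsingleton := by
  have hmax : ∀ v ∈ shadowPath A b c c', ∃ r ∈ Set.Icc (0 : ℝ) 1, DualFeasible A c c' v r ∧
      ∀ t ∈ Set.Icc (0 : ℝ) 1, DualFeasible A c c' v t → t ≤ r := by
    intro v hv
    obtain ⟨hvF, t, ht, hvt⟩ := mem_shadowPath_iff.1 hv
    obtain ⟨r, hr, hr'⟩ := (isCompact_Icc.inter_right
      (isClosed_dualFeasible (A := A) (c := c) (c' := c') v)).exists_isGreatest ⟨t, ht, hvt⟩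
    exact ⟨r, hr.1, hr.2, fun t ht h => hr' ⟨ht, h⟩⟩
  rintro v ⟨hv, hvn⟩ u ⟨hu, hun⟩
  by_contra hne
  obtain ⟨r, hr, hvr, hvmax⟩ := hmax v hv
  obtain ⟨s, hs, hus, humax⟩ := hmax u hu
  rcases le_total r s with h | h
  · exact hvn (exists_rightNbr hA hg hv.1 hu.1 (Ne.symm hne) hr hvr hvmax hs hus h)
  · exact hun (exists_rightNbr hA hg hu.1 hv.1 hne hs hus humax hr hvr h)

theorem subsingleton_not_leftNbr (hA : Nondegenerate A b) (hg : GenericSegment A c c') :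
    {v ∈ shadowPath A b c c' | ¬∃ u, RightNbr A b c c' u v}.Subsingleton := by
  refine (subsingleton_not_rightNbr hA hg.symm).anti ?_
  rintro v ⟨hv, hvn⟩
  refine ⟨?_, fun ⟨u, hu⟩ => hvn ⟨u, hu.symm⟩⟩
  rwa [shadowPath, segment_symm]

/-! ### Counting triples -/

/-- A vertex of `P ∩ S` with a predecessor and a successor in `S` has two neighbours in `S`,
distinct by asymmetry. Each vertex of `P \ S` spoils at most itself, its predecessor and its
successor; the term `2` is for the ends. -/
theorem ncard_le_triples_add {V : Type*} [Finite V] (G : SimpleGraph V) (R : V → V → Prop)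
    (P S : Set V) (hadj : ∀ v w, R v w → G.Adj v w) (hRP : ∀ v w, R v w → v ∈ P ∧ w ∈ P)
    (hl : ∀ v v' w, R v w → R v' w → v = v') (hr : ∀ v w w', R v w → R v w' → w = w')
    (hasymm : ∀ v w, R v w → ¬R w v)
    (hnr : {v ∈ P | ¬∃ w, R v w}.Subsingleton) (hnl : {v ∈ P | ¬∃ u, R u v}.Subsingleton) :
    P.ncard ≤ (triples G S).ncard + 2 + 3 * (P \ S).ncard := by
  classical
  have hcover : P ⊆ triples G S ∪ {v ∈ P | ¬∃ w, R v w} ∪ {v ∈ P | ¬∃ u, R u v} ∪ (P \ S) ∪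
      {v | ∃ w ∈ P \ S, R v w} ∪ {v | ∃ u ∈ P \ S, R u v} := by
    intro v hv
    by_cases hvS : v ∈ S
    swap
    · simp [hv, hvS]
    by_cases h1 : ∃ w, R v w
    swap
    · simp_all
    by_cases h2 : ∃ u, R u v
    swap
    · simp_all
    obtain ⟨w, hw⟩ := h1
    obtain ⟨u, hu⟩ := h2
    by_cases hwS : w ∈ S
    swap
    · exact Or.inl (Or.inr ⟨w, ⟨(hRP _ _ hw).2, hwS⟩, hw⟩)
    by_cases huS : u ∈ S
    swap
    · exact Or.inr ⟨u, ⟨(hRP _ _ hu).1, huS⟩, hu⟩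
    refine Or.inl (Or.inl (Or.inl (Or.inl (Or.inl ⟨hvS, ?_⟩))))
    have hne : u ≠ w := by
      rintro rfl
      exact hasymm _ _ hw hu
    rw [← Set.encard_pair hne]
    refine Set.encard_le_encard ?_
    rintro z (rfl | rfl)
    · exact ⟨(hadj _ _ hu).symm, huS⟩
    · exact ⟨hadj _ _ hw, hwS⟩
  -- Choosing a successor in `P \ S` is injective, because predecessors are unique.
  have hL : {v | ∃ w ∈ P \ S, R v w}.ncard ≤ (P \ S).ncard := by
    refine Set.ncard_le_ncard_of_injOn (fun v => if h : ∃ w ∈ P \ S, R v w then h.choose else v)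
      (fun v hv => ?_) (fun v hv v' hv' h => ?_) (Set.toFinite _)
    · simp only [Set.mem_ofPred_eq] at hv
      rw [dif_pos hv]
      exact hv.choose_spec.1
    · simp only [Set.mem_ofPred_eq] at hv hv'
      simp only [dif_pos hv, dif_pos hv'] at h
      exact hl _ _ _ hv.choose_spec.2 (by rw [h]; exact hv'.choose_spec.2)
  have hR : {v | ∃ u ∈ P \ S, R u v}.ncard ≤ (P \ S).ncard := by
    refine Set.ncard_le_ncard_of_injOn (fun v => if h : ∃ u ∈ P \ S, R u v then h.choose else v)
      (fun v hv => ?_) (fun v hv v' hv' h => ?_) (Set.toFinite _)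
    · simp only [Set.mem_ofPred_eq] at hv
      rw [dif_pos hv]
      exact hv.choose_spec.1
    · simp only [Set.mem_ofPred_eq] at hv hv'
      simp only [dif_pos hv, dif_pos hv'] at h
      exact hr _ _ _ hv.choose_spec.2 (by rw [h]; exact hv'.choose_spec.2)
  have h1 := Set.ncard_le_one_iff_subsingleton.2 hnr
  have h2 := Set.ncard_le_one_iff_subsingleton.2 hnl
  have h0 := Set.ncard_le_ncard hcover (Set.toFinite _)
  have e1 := Set.ncard_union_le (triples G S ∪ {v ∈ P | ¬∃ w, R v w} ∪ {v ∈ P | ¬∃ u, R u v} ∪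
    (P \ S) ∪ {v | ∃ w ∈ P \ S, R v w}) {v | ∃ u ∈ P \ S, R u v}
  have e2 := Set.ncard_union_le (triples G S ∪ {v ∈ P | ¬∃ w, R v w} ∪ {v ∈ P | ¬∃ u, R u v} ∪
    (P \ S)) {v | ∃ w ∈ P \ S, R v w}
  have e3 := Set.ncard_union_le (triples G S ∪ {v ∈ P | ¬∃ w, R v w} ∪
    {v ∈ P | ¬∃ u, R u v}) (P \ S)
  have e4 := Set.ncard_union_le (triples G S ∪ {v ∈ P | ¬∃ w, R v w}) {v ∈ P | ¬∃ u, R u v}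
  have e5 := Set.ncard_union_le (triples G S) {v ∈ P | ¬∃ w, R v w}
  omega

theorem ncard_shadowPath_le (hd : 1 ≤ d) (hA : Nondegenerate A b) (hg : GenericSegment A c c')
    (S : Set (IndexSet n d)) :
    (shadowPath A b c c').ncard ≤ (triples (shadowGraph A b c c') S).ncard + 2 +
      3 * (shadowPath A b c c' \ S).ncard :=
  ncard_le_triples_add _ (RightNbr A b c c') _ S (fun _ _ h => h.2.2.1)
    (fun _ _ h => ⟨h.2.2.1.1, h.2.2.1.2.1⟩) (fun _ _ _ h h' => h.left_unique hd hA hg h')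
    (fun _ _ _ h h' => h.right_unique hd hA hg h') (fun _ _ h h' => h.asymm hd hg h')
    (subsingleton_not_rightNbr hA hg) (subsingleton_not_leftNbr hA hg)

end

noncomputable section

/-! ### Gaussian distribution functions under small shifts -/

/-- The distribution function of the standard Gaussian. -/
def gaussianCdf (θ : ℝ) : ℝ := (gaussianReal 0 1).real (Set.Iic θ)

/-- The exponential is the likelihood ratio of the two unit-variance Gaussians. -/
theorem gaussianReal_real_add (m h : ℝ) {s : Set ℝ} (hs : MeasurableSet s) :
    (gaussianReal (m + h) 1).real s =
      ∫ x in s, Real.exp (h * (x - m) - h ^ 2 / 2) ∂gaussianReal m 1 := by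
  rw [measureReal_def, gaussianReal_apply_eq_integral _ one_ne_zero,
    ENNReal.toReal_ofReal (integral_nonneg fun x => gaussianPDFReal_nonneg _ _ _),
    ← integral_indicator hs, ← integral_indicator hs,
    integral_gaussianReal_eq_integral_smul one_ne_zero]
  congr 1
  ext x
  by_cases hx : x ∈ s
  · simp only [Set.indicator_of_mem hx, gaussianPDFReal, smul_eq_mul, mul_assoc, ← Real.exp_add]
    congr 3
    simp only [NNReal.coe_one]
    ring
  · simp [Set.indicator_of_notMem hx]

theorem integrable_exp_mul_sub_gaussianReal (m h a e : ℝ) :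
    Integrable (fun x => Real.exp (h * (x - a) + e)) (gaussianReal m 1) := by
  have : (fun x => Real.exp (h * (x - a) + e)) =
      fun x => Real.exp (h * x) * Real.exp (e - h * a) := by
    ext x
    rw [← Real.exp_add]
    ring_nf
  rw [this]
  exact (integrable_exp_mul_gaussianReal h).mul_const _

theorem integral_exp_mul_sub_gaussianReal (m h a e : ℝ) :
    ∫ x, Real.exp (h * (x - a) + e) ∂gaussianReal m 1 =
      Real.exp (m * h + h ^ 2 / 2 - h * a + e) := by
  have hfun : (fun x => Real.exp (h * (x - a) + e)) =
      fun x => Real.exp (h * x) * Real.exp (e - h * a) := by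
    ext x
    rw [← Real.exp_add]
    ring_nf
  have hmgf : ∫ x, Real.exp (h * x) ∂gaussianReal m 1 = Real.exp (m * h + h ^ 2 / 2) := by
    have := congrFun (mgf_fun_id_gaussianReal (μ := m) (v := 1)) h
    simpa [mgf] using this
  rw [hfun, integral_mul_const, hmgf, ← Real.exp_add]
  ring_nf

/-- Used to cut a Gaussian variable off at `K`: the exponential remainder has a mean of order
`e^{-K²/2}`. -/
theorem le_add_exp_div {K : ℝ} (hK : 0 < K) (u : ℝ) : u ≤ K + Real.exp (K * (u - K)) / K := by
  have h := Real.add_one_le_exp (K * (u - K))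
  have h2 : u - K ≤ Real.exp (K * (u - K)) / K := by
    rw [le_div_iff₀ hK]
    linarith
  linarith

theorem gaussianReal_one_real_Iic (h θ : ℝ) :
    (gaussianReal h 1).real (Set.Iic θ) = gaussianCdf (θ - h) := by
  have : gaussianReal h 1 = (gaussianReal 0 1).map (· + h) := by
    rw [gaussianReal_map_add_const, zero_add]
  rw [this, map_measureReal_apply (by fun_prop) measurableSet_Iic, gaussianCdf]
  congr 1
  ext x
  simp [le_sub_iff_add_le]

theorem gaussianReal_one_real_Ioi (h θ : ℝ) :
    (gaussianReal h 1).real (Set.Ioi θ) = 1 - gaussianCdf (θ - h) := by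
  rw [← gaussianReal_one_real_Iic, ← Set.compl_Iic, probReal_compl_eq_one_sub measurableSet_Iic]

/-- By the likelihood ratio and `1 - e^u ≤ -u`, the loss is at most the integral of `h²/2 - hx` over
`x ≤ θ`. Cutting `-x` off at `K` makes it proportional to `Φ(θ)`, up to a tail. -/
theorem gaussianCdf_sub_le_left {h K : ℝ} (hh : 0 ≤ h) (hK : 0 < K) (θ : ℝ) :
    gaussianCdf θ - gaussianCdf (θ - h) ≤
      (h ^ 2 / 2 + h * K) * gaussianCdf θ + h / K * Real.exp (-(K ^ 2 / 2)) := by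
  have hint := integrable_exp_mul_sub_gaussianReal 0 h 0 (-(h ^ 2 / 2))
  have hint2 := (integrable_exp_mul_sub_gaussianReal 0 (-K) (-K) 0).const_mul (h / K)
  have e1 : gaussianCdf (θ - h) =
      ∫ x in Set.Iic θ, Real.exp (h * (x - 0) + -(h ^ 2 / 2)) ∂gaussianReal 0 1 := by
    rw [← gaussianReal_one_real_Iic, ← zero_add h, gaussianReal_real_add 0 _ measurableSet_Iic]
    simp [sub_eq_add_neg]
  have e2 : gaussianCdf θ = ∫ _ in Set.Iic θ, (1 : ℝ) ∂gaussianReal 0 1 := by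
    simp [gaussianCdf]
  calc gaussianCdf θ - gaussianCdf (θ - h)
      = ∫ x in Set.Iic θ, (1 - Real.exp (h * (x - 0) + -(h ^ 2 / 2))) ∂gaussianReal 0 1 := by
        rw [integral_sub (integrable_const _) hint.integrableOn, ← e1, ← e2]
    _ ≤ ∫ x in Set.Iic θ, ((h ^ 2 / 2 + h * K) +
          h / K * Real.exp (-K * (x - -K) + 0)) ∂gaussianReal 0 1 := by
        refine integral_mono ((integrable_const _).sub hint.integrableOn)
          ((integrable_const _).add hint2.integrableOn) fun x => ?_
        have h1 := Real.add_one_le_exp (h * (x - 0) + -(h ^ 2 / 2))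
        have h2 := mul_le_mul_of_nonneg_left (le_add_exp_div hK (-x)) hh
        have h3 : -K * (x - -K) + 0 = K * (-x - K) := by ring
        have h4 : h / K * Real.exp (K * (-x - K)) = h * (Real.exp (K * (-x - K)) / K) := by ring
        simp only [h3, h4]
        linarith
    _ ≤ (h ^ 2 / 2 + h * K) * gaussianCdf θ +
          ∫ x, h / K * Real.exp (-K * (x - -K) + 0) ∂gaussianReal 0 1 := by
        rw [integral_add (integrable_const _) hint2.integrableOn]
        refine add_le_add (le_of_eq ?_) (setIntegral_le_integral hint2
          (Filter.Eventually.of_forall fun x => by positivity))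
        simp [gaussianCdf, mul_comm]
    _ = _ := by
        rw [integral_const_mul, integral_exp_mul_sub_gaussianReal]
        ring_nf

/-- The same argument for the upper tail, integrating against the Gaussian with mean `h`. It is the
useful bound when `Φ(θ)` is close to `1`. -/
theorem gaussianCdf_sub_le_right {h K : ℝ} (hh : 0 ≤ h) (hK : 0 < K) (θ : ℝ) :
    gaussianCdf θ - gaussianCdf (θ - h) ≤
      h * K * (1 - gaussianCdf (θ - h)) + h / K * Real.exp (K * h - K ^ 2 / 2) := by
  have hint := integrable_exp_mul_sub_gaussianReal h (-h) h (-(h ^ 2 / 2))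
  have hint2 := (integrable_exp_mul_sub_gaussianReal h K K 0).const_mul (h / K)
  have e1 : 1 - gaussianCdf θ =
      ∫ x in Set.Ioi θ, Real.exp (-h * (x - h) + -(h ^ 2 / 2)) ∂gaussianReal h 1 := by
    have := gaussianReal_real_add h (-h) (measurableSet_Ioi (a := θ))
    rw [add_neg_cancel, gaussianReal_one_real_Ioi, sub_zero] at this
    rw [this]
    simp [sub_eq_add_neg]
  have e2 : 1 - gaussianCdf (θ - h) = ∫ _ in Set.Ioi θ, (1 : ℝ) ∂gaussianReal h 1 := by
    simp [gaussianReal_one_real_Ioi]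
  calc gaussianCdf θ - gaussianCdf (θ - h)
      = ∫ x in Set.Ioi θ, (1 - Real.exp (-h * (x - h) + -(h ^ 2 / 2))) ∂gaussianReal h 1 := by
        rw [integral_sub (integrable_const _) hint.integrableOn, ← e1, ← e2]
        ring
    _ ≤ ∫ x in Set.Ioi θ, (h * K + h / K * Real.exp (K * (x - K) + 0)) ∂gaussianReal h 1 := by
        refine integral_mono ((integrable_const _).sub hint.integrableOn)
          ((integrable_const _).add hint2.integrableOn) fun x => ?_
        have h1 := Real.add_one_le_exp (-h * (x - h) + -(h ^ 2 / 2))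
        have h2 := mul_le_mul_of_nonneg_left (le_add_exp_div hK x) hh
        have h4 : h / K * Real.exp (K * (x - K) + 0) = h * (Real.exp (K * (x - K)) / K) := by
          rw [add_zero]
          ring
        simp only [h4]
        nlinarith [sq_nonneg h]
    _ ≤ h * K * (1 - gaussianCdf (θ - h)) +
          ∫ x, h / K * Real.exp (K * (x - K) + 0) ∂gaussianReal h 1 := by
        rw [integral_add (integrable_const _) hint2.integrableOn]
        refine add_le_add (le_of_eq ?_) (setIntegral_le_integral hint2
          (Filter.Eventually.of_forall fun x => by positivity))
        simp [gaussianReal_one_real_Ioi, mul_comm]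
    _ = _ := by
        rw [integral_const_mul, integral_exp_mul_sub_gaussianReal]
        ring_nf

theorem gaussianCdf_nonneg (θ : ℝ) : 0 ≤ gaussianCdf θ := measureReal_nonneg

theorem gaussianCdf_le_one (θ : ℝ) : gaussianCdf θ ≤ 1 := measureReal_le_one

/-- The relative loss is measured by `-log Φ(θ)` because this quantity adds up over a product. Below
`1/2` the left bound applies and `-log Φ(θ) ≥ 1/2`, which gives the factor `6`. Otherwise the right
bound applies with `1 - Φ(θ) ≤ -log Φ(θ)`, and dividing by `Φ(θ) ≥ 1/2` gives the factor `8`. -/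
theorem gaussianCdf_mul_le {h K : ℝ} (hh : 0 ≤ h) (hK : 1 ≤ K) (hhK : h * K ≤ 1 / 2) {θ : ℝ}
    (hθ : Real.exp (-(K ^ 2 / 2)) ≤ gaussianCdf θ) :
    gaussianCdf θ * (1 - (6 * (h * K) * -Real.log (gaussianCdf θ) +
      8 * h * Real.exp (-(K ^ 2 / 2)))) ≤ gaussianCdf (θ - h) := by
  have hpos : 0 < gaussianCdf θ := (Real.exp_pos _).trans_le hθ
  have hE := Real.exp_pos (-(K ^ 2 / 2))
  have hK0 : 0 < K := one_pos.trans_le hK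
  have hhK' : h ≤ h * K := le_mul_of_one_le_right hh hK
  have hdiv : h / K ≤ h := div_le_self hh hK
  have hlog : 1 - gaussianCdf θ ≤ -Real.log (gaussianCdf θ) := by
    have := Real.log_le_sub_one_of_pos hpos
    linarith
  have hlog0 : 0 ≤ -Real.log (gaussianCdf θ) := by
    linarith [gaussianCdf_le_one θ]
  have hhK0 : 0 ≤ h * K := mul_nonneg hh hK0.le
  rcases lt_or_ge (gaussianCdf θ) (1 / 2) with hlt | hge
  · have h1 := gaussianCdf_sub_le_left hh hK0 θ
    have h2 : h / K * Real.exp (-(K ^ 2 / 2)) ≤ h * gaussianCdf θ :=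
      mul_le_mul hdiv hθ hE.le hh
    have h3 : 1 / 2 ≤ -Real.log (gaussianCdf θ) := by linarith
    have h4 : 3 * (h * K) ≤ 6 * (h * K) * -Real.log (gaussianCdf θ) := by nlinarith
    have h5 : h ^ 2 / 2 + h * K + h ≤ 3 * (h * K) := by nlinarith
    have h6 : (h ^ 2 / 2 + h * K + h) * gaussianCdf θ ≤
        (6 * (h * K) * -Real.log (gaussianCdf θ) + 8 * h * Real.exp (-(K ^ 2 / 2))) *
          gaussianCdf θ := by
      refine mul_le_mul_of_nonneg_right ?_ hpos.le
      have : 0 ≤ 8 * h * Real.exp (-(K ^ 2 / 2)) := by positivity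
      linarith
    linarith
  · have h1 := gaussianCdf_sub_le_right hh hK0 θ
    have hexp : Real.exp (K * h - K ^ 2 / 2) ≤ 2 * Real.exp (-(K ^ 2 / 2)) := by
      rw [sub_eq_add_neg, Real.exp_add]
      refine mul_le_mul_of_nonneg_right ?_ hE.le
      have h7 : Real.exp (K * h) ≤ Real.exp (Real.log 2) := by
        rw [Real.exp_le_exp]
        have := Real.log_two_gt_d9
        linarith [mul_comm h K]
      rwa [Real.exp_log two_pos] at h7
    have h2 : h / K * Real.exp (K * h - K ^ 2 / 2) ≤ h * (2 * Real.exp (-(K ^ 2 / 2))) :=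
      mul_le_mul hdiv hexp (Real.exp_pos _).le hh
    set D := gaussianCdf θ - gaussianCdf (θ - h) with hD
    -- The right bound involves `1 - Φ(θ - h) = 1 - Φ(θ) + D`. The `D` is absorbed on the left,
    -- where `1 - hK ≥ 1/2`.
    have h3 : D * (1 - h * K) ≤ h * K * (1 - gaussianCdf θ) +
        h * (2 * Real.exp (-(K ^ 2 / 2))) := by
      have : 1 - gaussianCdf (θ - h) = 1 - gaussianCdf θ + D := by rw [hD]; ring
      rw [this] at h1
      linarith
    have h4 : D ≤ 2 * (h * K * (1 - gaussianCdf θ) + h * (2 * Real.exp (-(K ^ 2 / 2)))) := by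
      rcases le_or_gt D 0 with h0 | h0
      · refine h0.trans ?_
        have := sub_nonneg.2 (gaussianCdf_le_one θ)
        positivity
      · nlinarith
    have h5 : h * K * (1 - gaussianCdf θ) ≤ h * K * -Real.log (gaussianCdf θ) :=
      mul_le_mul_of_nonneg_left hlog hhK0
    have h6 : 0 ≤ h * K * -Real.log (gaussianCdf θ) := mul_nonneg hhK0 hlog0
    have h7 : 0 ≤ h * Real.exp (-(K ^ 2 / 2)) := mul_nonneg hh hE.le
    have h8 : 2 * (h * K * -Real.log (gaussianCdf θ) + h * (2 * Real.exp (-(K ^ 2 / 2)))) ≤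
        gaussianCdf θ * (6 * (h * K) * -Real.log (gaussianCdf θ) +
          8 * h * Real.exp (-(K ^ 2 / 2))) := by
      nlinarith
    linarith

theorem prod_mul_one_sub_sum_le {ι : Type*} (s : Finset ι) (p q r : ι → ℝ)
    (hp : ∀ i ∈ s, 0 ≤ p i) (hr : ∀ i ∈ s, 0 ≤ r i) (hq : ∀ i ∈ s, 0 ≤ q i)
    (h : ∀ i ∈ s, p i * (1 - r i) ≤ q i) :
    (∏ i ∈ s, p i) * (1 - ∑ i ∈ s, r i) ≤ ∏ i ∈ s, q i := by
  classical
  induction s using Finset.induction_on with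
  | empty => simp
  | insert a s ha ih =>
    simp only [Finset.forall_mem_insert] at hp hr hq h
    specialize ih hp.2 hr.2 hq.2 h.2
    rw [Finset.prod_insert ha, Finset.prod_insert ha, Finset.sum_insert ha]
    have hP := Finset.prod_nonneg hp.2
    have hR := Finset.sum_nonneg hr.2
    rcases le_or_gt (1 - (r a + ∑ i ∈ s, r i)) 0 with h0 | h0
    · exact (mul_nonpos_of_nonneg_of_nonpos (mul_nonneg hp.1 hP) h0).trans
        (mul_nonneg hq.1 (Finset.prod_nonneg hq.2))
    · have h1 : 0 ≤ p a * (1 - r a) := mul_nonneg hp.1 (by linarith)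
      have h2 : 0 ≤ (∏ i ∈ s, p i) * (1 - ∑ i ∈ s, r i) := mul_nonneg hP (by linarith [hr.1])
      refine le_trans ?_ (mul_le_mul h.1 ih h2 hq.1)
      have h3 : 0 ≤ p a * ∏ i ∈ s, p i := mul_nonneg hp.1 hP
      have h4 := mul_nonneg h3 (mul_nonneg hr.1 hR)
      linarith

/-- A product below `e^{-L}` is covered by the additive error. Otherwise each factor is at least
`e^{-L}` and the numbers `-log Φ(θ_i)` add up to at most `L`, so the relative losses, taken with `K
= √(2L)`, sum to at most `1/10`. -/
theorem prod_gaussianCdf_sub_le {ι : Type*} (s : Finset ι) (θ : ι → ℝ) {h L : ℝ} (hL : 1 / 2 ≤ L)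
    (hh : 0 ≤ h) (hhK : h * √(2 * L) ≤ 1 / 400) (hhL : h * √(2 * L) * L ≤ 1 / 400)
    (hs : s.card * Real.exp (-L) ≤ 1) :
    ∏ i ∈ s, gaussianCdf (θ i) - ∏ i ∈ s, gaussianCdf (θ i - h) ≤
      1 / 10 * ∏ i ∈ s, gaussianCdf (θ i) + Real.exp (-L) := by
  have hP : 0 ≤ ∏ i ∈ s, gaussianCdf (θ i) := Finset.prod_nonneg fun i _ => gaussianCdf_nonneg _
  have hQ : 0 ≤ ∏ i ∈ s, gaussianCdf (θ i - h) :=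
    Finset.prod_nonneg fun i _ => gaussianCdf_nonneg _
  rcases lt_or_ge (∏ i ∈ s, gaussianCdf (θ i)) (Real.exp (-L)) with hlt | hge
  · linarith
  have hK : 1 ≤ √(2 * L) := Real.one_le_sqrt.2 (by linarith)
  have hK2 : √(2 * L) ^ 2 / 2 = L := by
    rw [Real.sq_sqrt (by linarith)]
    ring
  have hpos : ∀ i ∈ s, 0 < gaussianCdf (θ i) := fun i hi => by
    refine (gaussianCdf_nonneg _).lt_of_ne' fun h0 => ?_
    rw [Finset.prod_eq_zero hi h0] at hge
    exact absurd hge (not_le.2 (Real.exp_pos _))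
  have hEle : ∀ i ∈ s, Real.exp (-(√(2 * L) ^ 2 / 2)) ≤ gaussianCdf (θ i) := fun i hi => by
    rw [hK2]
    refine hge.trans ?_
    classical
    rw [← Finset.mul_prod_erase s _ hi]
    exact mul_le_of_le_one_right (gaussianCdf_nonneg _)
      (Finset.prod_le_one (fun j _ => gaussianCdf_nonneg _) fun j _ => gaussianCdf_le_one _)
  have hlog : ∑ i ∈ s, -Real.log (gaussianCdf (θ i)) ≤ L := by
    rw [Finset.sum_neg_distrib, ← Real.log_prod fun i hi => (hpos i hi).ne']
    have := Real.log_le_log (Real.exp_pos _) hge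
    rw [Real.log_exp] at this
    linarith
  have hlog0 : ∀ i ∈ s, 0 ≤ -Real.log (gaussianCdf (θ i)) := fun i hi => by
    have := Real.log_nonpos (gaussianCdf_nonneg (θ i)) (gaussianCdf_le_one _)
    linarith
  have hhK0 : 0 ≤ h * √(2 * L) := by positivity
  have key := prod_mul_one_sub_sum_le s (fun i => gaussianCdf (θ i))
    (fun i => gaussianCdf (θ i - h))
    (fun i => 6 * (h * √(2 * L)) * -Real.log (gaussianCdf (θ i)) +
      8 * h * Real.exp (-(√(2 * L) ^ 2 / 2)))
    (fun i _ => gaussianCdf_nonneg _)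
    (fun i hi => add_nonneg (mul_nonneg (by positivity) (hlog0 i hi)) (by positivity))
    (fun i _ => gaussianCdf_nonneg _)
    (fun i hi => gaussianCdf_mul_le hh hK (by linarith) (hEle i hi))
  have hsum : ∑ i ∈ s, (6 * (h * √(2 * L)) * -Real.log (gaussianCdf (θ i)) +
      8 * h * Real.exp (-(√(2 * L) ^ 2 / 2))) ≤ 1 / 10 := by
    rw [Finset.sum_add_distrib, ← Finset.mul_sum, Finset.sum_const, nsmul_eq_mul, hK2]
    have h1 := mul_le_mul_of_nonneg_left hlog hhK0
    have h2 := mul_le_mul_of_nonneg_left hs hh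
    have h3 : h ≤ h * √(2 * L) := le_mul_of_one_le_right hh hK
    linarith
  have := (mul_le_mul_of_nonneg_left (sub_le_sub_left hsum 1) hP).trans key
  linarith [Real.exp_pos (-L)]

end

noncomputable section

variable {d : ℕ}

/-! ### Gaussian rows -/

/-- The law of a Gaussian vector with independent entries of variance `v` and mean `m`. -/
def rowLaw (v : NNReal) (m : Fin d → ℝ) : Measure (Fin d → ℝ) :=
  Measure.pi fun k => gaussianReal (m k) v

instance (v : NNReal) (m : Fin d → ℝ) : IsProbabilityMeasure (rowLaw v m) := by
  unfold rowLaw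
  infer_instance

theorem measurable_dotProduct_const (x : Fin d → ℝ) : Measurable fun a : Fin d → ℝ => a ⬝ᵥ x := by
  unfold dotProduct
  fun_prop

theorem rowLaw_map_dotProduct (v : NNReal) (m x : Fin d → ℝ) :
    (rowLaw v m).map (fun a => a ⬝ᵥ x) =
      gaussianReal (m ⬝ᵥ x) (v * ‖WithLp.toLp 2 x‖₊ ^ 2) := by
  have hm := measurable_dotProduct_const x
  have : IsProbabilityMeasure ((rowLaw v m).map (fun a => a ⬝ᵥ x)) :=
    Measure.isProbabilityMeasure_map hm.aemeasurable
  apply Measure.ext_of_charFun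
  ext t
  rw [charFun_gaussianReal, charFun_apply_real, integral_map hm.aemeasurable (by fun_prop)]
  have h1 : ∀ a : Fin d → ℝ, Complex.exp (t * (a ⬝ᵥ x : ℝ) * Complex.I) =
      ∏ k, Complex.exp (((t * x k : ℝ) : ℂ) * (a k : ℂ) * Complex.I) := fun a => by
    rw [← Complex.exp_sum]
    congr 1
    simp only [dotProduct]
    push_cast
    rw [Finset.mul_sum, Finset.sum_mul]
    exact Finset.sum_congr rfl fun k _ => by ring
  simp only [h1]
  rw [rowLaw, integral_fintype_prod_eq_prod (𝕜 := ℂ)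
    (fun k (s : ℝ) => Complex.exp (((t * x k : ℝ) : ℂ) * (s : ℂ) * Complex.I))]
  simp only [← charFun_apply_real, charFun_gaussianReal]
  rw [← Complex.exp_sum]
  congr 1
  have h2 : ((‖WithLp.toLp 2 x‖₊ ^ 2 : NNReal) : ℝ) = ∑ k, x k ^ 2 := by
    rw [NNReal.coe_pow, coe_nnnorm, EuclideanSpace.norm_sq_eq]
    simp
  have h3 : (((v * ‖WithLp.toLp 2 x‖₊ ^ 2 : NNReal) : ℝ) : ℂ) = v * ∑ k, (x k : ℂ) ^ 2 := by
    rw [NNReal.coe_mul, h2]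
    push_cast
    rfl
  rw [h3]
  simp only [dotProduct]
  push_cast
  rw [Finset.sum_sub_distrib, ← Finset.sum_div]
  congr 1
  · rw [Finset.mul_sum, Finset.sum_mul]
    exact Finset.sum_congr rfl fun k _ => by ring
  · congr 1
    rw [Finset.mul_sum, Finset.sum_mul]
    exact Finset.sum_congr rfl fun k _ => by ring

theorem gaussianReal_real_Iic {s : ℝ} (hs : 0 < s) {v : NNReal} (hv : (v : ℝ) = s ^ 2) (m t : ℝ) :
    (gaussianReal m v).real (Set.Iic t) = gaussianCdf ((t - m) / s) := by
  have : gaussianReal m v = ((gaussianReal 0 1).map (s * ·)).map (m + ·) := by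
    rw [gaussianReal_map_const_mul, gaussianReal_map_const_add]
    congr 1
    · ring
    · ext
      simp [hv]
  rw [this, map_measureReal_apply (by fun_prop) measurableSet_Iic,
    map_measureReal_apply (by fun_prop) (measurableSet_Iic.preimage (by fun_prop)), gaussianCdf]
  congr 1
  ext x
  simp only [Set.mem_preimage, Set.mem_Iic]
  rw [le_div_iff₀ hs]
  constructor <;> intro h <;> linarith

theorem rowLaw_halfspace {σ : ℝ} (hσ : 0 < σ) (m : Fin d → ℝ) {x : Fin d → ℝ} (hx : x ≠ 0)
    (t : ℝ) : (rowLaw (σ ^ 2).toNNReal m).real {a | a ⬝ᵥ x ≤ t} =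
      gaussianCdf ((t - m ⬝ᵥ x) / (σ * ‖WithLp.toLp 2 x‖)) := by
  have hx' : 0 < ‖WithLp.toLp 2 x‖ := norm_pos_iff.2 fun h => hx (congrArg WithLp.ofLp h)
  rw [← gaussianReal_real_Iic (v := (σ ^ 2).toNNReal * ‖WithLp.toLp 2 x‖₊ ^ 2) (mul_pos hσ hx'),
    ← rowLaw_map_dotProduct, map_measureReal_apply (measurable_dotProduct_const x)
      measurableSet_Iic]
  · rfl
  · simp [Real.coe_toNNReal _ (sq_nonneg σ), mul_pow]

theorem rowLaw_hyperplane {σ : ℝ} (hσ : 0 < σ) (m : Fin d → ℝ) {x : Fin d → ℝ} (hx : x ≠ 0)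
    (t : ℝ) : rowLaw (σ ^ 2).toNNReal m {a | a ⬝ᵥ x = t} = 0 := by
  have h : rowLaw (σ ^ 2).toNNReal m ((fun a => a ⬝ᵥ x) ⁻¹' {t}) = 0 := by
    rw [← Measure.map_apply (measurable_dotProduct_const x) (measurableSet_singleton t),
      rowLaw_map_dotProduct]
    have hne : (σ ^ 2).toNNReal * ‖WithLp.toLp 2 x‖₊ ^ 2 ≠ 0 := by
      refine mul_ne_zero (by simpa using hσ.ne') (pow_ne_zero _ ?_)
      simpa using hx
    have := nullSingletonClass_gaussianReal (μ := m ⬝ᵥ x) hne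
    exact measure_singleton t
  exact h

theorem integral_exp_sq_gaussianReal (m : ℝ) {v : NNReal} (hv : v ≠ 0) :
    ∫ x, Real.exp ((x - m) ^ 2 / (4 * v)) ∂gaussianReal m v = √2 := by
  rw [integral_gaussianReal_eq_integral_smul hv]
  have hv' : (0 : ℝ) < v := by positivity
  have h1 : ∀ x : ℝ, gaussianPDFReal m v x • Real.exp ((x - m) ^ 2 / (4 * v)) =
      (√(2 * Real.pi * v))⁻¹ * Real.exp (-(1 / (4 * v)) * (x - m) ^ 2) := fun x => by
    rw [gaussianPDFReal, smul_eq_mul, mul_assoc, ← Real.exp_add]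
    congr 2
    field_simp
    ring
  simp only [h1]
  rw [integral_const_mul, integral_sub_right_eq_self (fun x => Real.exp (-(1 / (4 * v)) * x ^ 2)) m,
    integral_gaussian, ← Real.sqrt_inv, ← Real.sqrt_mul (by positivity)]
  congr 1
  field_simp
  ring

/-- A long row deviates from its mean by more than `1`. Markov's inequality is applied to `exp(‖a -
m‖² / (4σ²))`, whose mean is `√2` per coordinate. -/
theorem rowLaw_norm_gt {σ : ℝ} (hσ : 0 < σ) {m : Fin d → ℝ} (hm : ‖WithLp.toLp 2 m‖ ≤ 1) :
    (rowLaw (σ ^ 2).toNNReal m).real {a | 2 < ‖WithLp.toLp 2 a‖} ≤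
      √2 ^ d * Real.exp (-(1 / (4 * σ ^ 2))) := by
  set v := (σ ^ 2).toNNReal with hvdef
  have hv : v ≠ 0 := by simpa [hvdef] using hσ.ne'
  have hvσ : (v : ℝ) = σ ^ 2 := Real.coe_toNNReal _ (sq_nonneg σ)
  have hint : ∫ a, ∏ k, Real.exp ((a k - m k) ^ 2 / (4 * v)) ∂rowLaw v m = √2 ^ d := by
    rw [rowLaw, integral_fintype_prod_eq_prod (𝕜 := ℝ)
      (fun k (s : ℝ) => Real.exp ((s - m k) ^ 2 / (4 * v)))]
    simp [integral_exp_sq_gaussianReal _ hv]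
  -- The integral of a nonintegrable function is `0` by convention, while this one is `√2 ^ d`.
  have hintegrable : Integrable (fun a : Fin d → ℝ => ∏ k, Real.exp ((a k - m k) ^ 2 / (4 * v)))
      (rowLaw v m) := by
    by_contra h
    rw [integral_undef h] at hint
    exact (pow_pos (Real.sqrt_pos.2 two_pos) d).ne hint
  have hmarkov := mul_meas_ge_le_integral_of_nonneg
    (Filter.Eventually.of_forall fun a : Fin d → ℝ =>
      Finset.prod_nonneg fun k _ => (Real.exp_pos ((a k - m k) ^ 2 / (4 * v))).le)
    hintegrable (Real.exp (1 / (4 * σ ^ 2)))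
  rw [hint] at hmarkov
  rw [Real.exp_neg, ← div_eq_mul_inv, le_div_iff₀ (Real.exp_pos _), mul_comm]
  refine le_trans (mul_le_mul_of_nonneg_left (measureReal_mono ?_) (Real.exp_pos _).le) hmarkov
  intro a ha
  simp only [Set.mem_ofPred_eq] at ha ⊢
  rw [← Real.exp_sum, Real.exp_le_exp, ← Finset.sum_div, hvσ]
  refine div_le_div_of_nonneg_right ?_ (by positivity)
  have h1 : ‖WithLp.toLp 2 (a - m)‖ ^ 2 = ∑ k, (a k - m k) ^ 2 := by
    rw [EuclideanSpace.norm_sq_eq]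
    simp
  rw [← h1]
  have h2 : ‖WithLp.toLp 2 a‖ ≤ ‖WithLp.toLp 2 (a - m)‖ + ‖WithLp.toLp 2 m‖ := by
    rw [WithLp.toLp_sub]
    exact norm_le_norm_sub_add _ _
  have h3 : 1 ≤ ‖WithLp.toLp 2 (a - m)‖ := by linarith
  nlinarith

/-! ### The shift -/

theorem measurable_of_isLogLipschitz {E : Type*} [NormedAddCommGroup E] [MeasurableSpace E]
    [BorelSpace E] {f : E → ℝ} {C : ℝ} (hf : IsLogLipschitz C f) : Measurable f := by
  have h : f = fun x => Real.exp (Real.log (f x)) := funext fun x => (Real.exp_log (hf.1 x)).symm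
  rw [h]
  refine Real.measurable_exp.comp (Continuous.measurable ?_)
  refine (LipschitzWith.of_dist_le_mul (K := C.toNNReal) fun x y => ?_).continuous
  rw [Real.dist_eq, dist_eq_norm]
  exact (hf.2 x y).trans (mul_le_mul_of_nonneg_right (Real.le_coe_toNNReal C) (norm_nonneg _))

/-- The law with density `f`. -/
def shiftLaw (f : EuclideanSpace ℝ (Fin d) → ℝ) : Measure (EuclideanSpace ℝ (Fin d)) :=
  volume.withDensity fun z => ENNReal.ofReal (f z)

/-- Lebesgue measure is translation invariant, and the density changes by a factor of at most
`e^{‖w‖}` under translation by `w`. -/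
theorem shiftLaw_translate_ge {f : EuclideanSpace ℝ (Fin d) → ℝ} (hf : IsLogLipschitz 1 f)
    (w : EuclideanSpace ℝ (Fin d)) {D : Set (EuclideanSpace ℝ (Fin d))} (hD : MeasurableSet D) :
    ENNReal.ofReal (Real.exp (-‖w‖)) * shiftLaw f D ≤ shiftLaw f ((fun z => z - w) ⁻¹' D) := by
  have hfm := measurable_of_isLogLipschitz hf
  have hD' : MeasurableSet ((fun z => z - w) ⁻¹' D) := hD.preimage (by fun_prop)
  rw [shiftLaw, withDensity_apply _ hD, withDensity_apply _ hD',
    ← lintegral_const_mul _ hfm.ennreal_ofReal, ← lintegral_indicator hD,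
    ← lintegral_indicator hD', ← lintegral_sub_right_eq_self _ w]
  refine lintegral_mono fun z => ?_
  by_cases hz : z - w ∈ D
  · rw [Set.indicator_of_mem hz, Set.indicator_of_mem (by exact hz),
      ← ENNReal.ofReal_mul (Real.exp_pos _).le]
    refine ENNReal.ofReal_le_ofReal ?_
    have h := (abs_le.1 (hf.2 (z - w) z)).2
    rw [sub_sub_cancel_left, norm_neg, one_mul] at h
    rw [← Real.exp_log (hf.1 (z - w)), ← Real.exp_log (hf.1 z), ← Real.exp_add, Real.exp_le_exp]
    linarith
  · rw [Set.indicator_of_notMem hz]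
    exact zero_le

theorem shiftLaw_levelSet (f : EuclideanSpace ℝ (Fin d) → ℝ)
    (l : EuclideanSpace ℝ (Fin d) →ₗ[ℝ] ℝ) (hl : l ≠ 0) (t : ℝ) :
    shiftLaw f {z | l z = t} = 0 := by
  refine withDensity_absolutelyContinuous _ _ ?_
  obtain ⟨z₀, hz₀⟩ := LinearMap.surjective hl t
  have h : {z | l z = t} = (AffineSubspace.mk' z₀ (LinearMap.ker l) : Set _) := by
    ext z
    simp [AffineSubspace.mem_mk', ← hz₀, sub_eq_zero]
  rw [h]
  refine Measure.addHaar_affineSubspace _ _ fun htop => hl ?_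
  have := congrArg AffineSubspace.direction htop
  rwa [AffineSubspace.direction_mk', AffineSubspace.direction_top, LinearMap.ker_eq_top] at this

end

noncomputable section

variable {n d : ℕ} {b : Fin n → ℝ} {c c' : EuclideanSpace ℝ (Fin d)}

/-! ### Measurability -/

theorem measurableSet_isUnit_subMatrix (I : IndexSet n d) :
    MeasurableSet {a : Fin n → Fin d → ℝ | IsUnit (subMatrix (Matrix.of a) I)} := by
  have h : Continuous fun a : Fin n → Fin d → ℝ => (subMatrix (Matrix.of a) I).det :=
    Continuous.matrix_det (by unfold subMatrix; exact continuous_pi fun k => continuous_pi fun l =>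
      (continuous_apply l).comp (continuous_apply _))
  have h2 : {a : Fin n → Fin d → ℝ | IsUnit (subMatrix (Matrix.of a) I)} =
      {a | (subMatrix (Matrix.of a) I).det ≠ 0} := by
    ext a
    simp [Matrix.isUnit_iff_isUnit_det, isUnit_iff_ne_zero]
  rw [h2]
  exact (isClosed_singleton.preimage h).isOpen_compl.measurableSet

theorem measurable_inv_subMatrix (I : IndexSet n d) (k l : Fin d) :
    Measurable fun a : Fin n → Fin d → ℝ => (subMatrix (Matrix.of a) I)⁻¹ k l := by
  have h0 : Continuous fun a : Fin n → Fin d → ℝ => subMatrix (Matrix.of a) I := by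
    unfold subMatrix
    exact continuous_pi fun k => continuous_pi fun l =>
      (continuous_apply l).comp (continuous_apply _)
  simp only [Matrix.inv_def, Ring.inverse_eq_inv', Matrix.smul_apply, smul_eq_mul]
  exact (h0.matrix_det.measurable.inv).mul (h0.matrix_adjugate.matrix_elem k l).measurable

theorem measurable_basicSolution_apply (b : Fin n → ℝ) (I : IndexSet n d) (k : Fin d) :
    Measurable fun a : Fin n → Fin d → ℝ => (basicSolution (Matrix.of a) b I).ofLp k := by
  simp only [basicSolution, Matrix.mulVec, dotProduct]
  exact Finset.measurable_fun_sum _ fun l _ => (measurable_inv_subMatrix I k l).mul_const _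

theorem measurable_basicSolution (b : Fin n → ℝ) (I : IndexSet n d) :
    Measurable fun a : Fin n → Fin d → ℝ => basicSolution (Matrix.of a) b I :=
  (WithLp.measurable_toLp 2 (Fin d → ℝ)).comp
    (measurable_pi_lambda _ fun k => measurable_basicSolution_apply b I k)

theorem measurable_mulVec_basicSolution (b : Fin n → ℝ) (I : IndexSet n d) (j : Fin n) :
    Measurable fun a : Fin n → Fin d → ℝ =>
      (Matrix.of a *ᵥ (basicSolution (Matrix.of a) b I).ofLp) j := by
  simp only [Matrix.mulVec, dotProduct]
  exact Finset.measurable_fun_sum _ fun l _ =>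
    (by fun_prop : Measurable fun a : Fin n → Fin d → ℝ => Matrix.of a j l).mul
      (measurable_basicSolution_apply b I l)

theorem measurableSet_gapBases (b : Fin n → ℝ) (g : ℝ) (I : IndexSet n d) :
    MeasurableSet {a : Fin n → Fin d → ℝ | I ∈ gapBases (Matrix.of a) b g} := by
  have hU := measurableSet_isUnit_subMatrix I
  refine MeasurableSet.inter (MeasurableSet.inter hU ?_) ?_
  · simp only [polyhedron]
    exact measurableSet_setOfPred.2 (Measurable.forall fun j =>
      measurableSet_setOfPred.1 (measurableSet_le (measurable_mulVec_basicSolution b I j)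
        measurable_const))
  · refine measurableSet_setOfPred.2 (Measurable.forall fun j => ?_)
    refine Measurable.imp measurable_const (measurableSet_setOfPred.1
      (measurableSet_le (measurable_mulVec_basicSolution b I j) ?_))
    exact measurable_const.sub ((measurable_basicSolution b I).norm.const_mul g)

theorem gapBases_zero (A : Matrix (Fin n) (Fin d) ℝ) (b : Fin n → ℝ) :
    gapBases A b 0 = feasibleBases A b := by
  ext I
  refine ⟨fun h => h.1, fun h => ⟨h, fun j _ => ?_⟩⟩
  rw [zero_mul, sub_zero]
  exact h.2 j

theorem measurable_vecMul_inv_subMatrix (I : IndexSet n d)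
    {y : (Fin n → Fin d → ℝ) × EuclideanSpace ℝ (Fin d) → EuclideanSpace ℝ (Fin d)}
    (hy : Measurable y) (k : Fin d) :
    Measurable fun p : (Fin n → Fin d → ℝ) × EuclideanSpace ℝ (Fin d) =>
      ((y p).ofLp ᵥ* (subMatrix (Matrix.of p.1) I)⁻¹) k := by
  simp only [Matrix.vecMul, dotProduct]
  refine Finset.measurable_fun_sum _ fun l _ => Measurable.mul ?_
    ((measurable_inv_subMatrix I l k).comp measurable_fst)
  exact (measurable_pi_apply l).comp ((WithLp.measurable_ofLp 2 (Fin d → ℝ)).comp hy)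

/-- Projecting out the compact parameter interval preserves closedness. This makes the existential
over the segment measurable. -/
theorem isClosed_setOf_exists_affine_ge (m : ℝ) :
    IsClosed {p : (Fin d → ℝ) × (Fin d → ℝ) |
      ∃ t ∈ Set.Icc (0 : ℝ) 1, ∀ k, m ≤ p.1 k + t * p.2 k} := by
  have h : IsClosed {q : Set.Icc (0 : ℝ) 1 × ((Fin d → ℝ) × (Fin d → ℝ)) |
      ∀ k, m ≤ q.2.1 k + (q.1 : ℝ) * q.2.2 k} := by
    simp only [Set.ofPred_forall]
    exact isClosed_iInter fun k => isClosed_le continuous_const (by fun_prop)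
  convert isClosedMap_snd_of_compactSpace _ h using 1
  ext p
  simp

theorem mem_multiplierBases_iff {A : Matrix (Fin n) (Fin d) ℝ} {I : IndexSet n d} {m : ℝ} :
    I ∈ multiplierBases A c c' m ↔ IsUnit (subMatrix A I) ∧ ∃ t ∈ Set.Icc (0 : ℝ) 1,
      ∀ k, m ≤ (c.ofLp ᵥ* (subMatrix A I)⁻¹) k + t * ((c' - c).ofLp ᵥ* (subMatrix A I)⁻¹) k := by
  refine and_congr_right fun _ => ?_
  rw [segment_eq_image_lineMap]
  simp only [Set.exists_mem_image]
  refine exists_congr fun t => and_congr_right fun _ => forall_congr' fun k => ?_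
  rw [AffineMap.lineMap_apply, vsub_eq_sub, vadd_eq_add, WithLp.ofLp_add, WithLp.ofLp_smul,
    Matrix.add_vecMul, Matrix.smul_vecMul, Pi.add_apply, Pi.smul_apply, smul_eq_mul, add_comm]

theorem measurableSet_multiplierBases (c c' : EuclideanSpace ℝ (Fin d)) (m : ℝ)
    (I : IndexSet n d) :
    MeasurableSet {p : (Fin n → Fin d → ℝ) × EuclideanSpace ℝ (Fin d) |
      I ∈ multiplierBases (Matrix.of p.1) (c + p.2) (c' + p.2) m} := by
  simp only [mem_multiplierBases_iff]
  refine MeasurableSet.inter ((measurableSet_isUnit_subMatrix I).preimage measurable_fst) ?_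
  exact (isClosed_setOf_exists_affine_ge m).measurableSet.preimage
    ((measurable_pi_lambda _ fun k => measurable_vecMul_inv_subMatrix I (by fun_prop) k).prodMk
      (measurable_pi_lambda _ fun k => measurable_vecMul_inv_subMatrix I (by fun_prop) k))

theorem shadowPath_eq (A : Matrix (Fin n) (Fin d) ℝ) (b : Fin n → ℝ)
    (c c' : EuclideanSpace ℝ (Fin d)) :
    shadowPath A b c c' = feasibleBases A b ∩ multiplierBases A c c' 0 := by
  ext I
  refine and_congr_right fun hI => ?_
  refine Iff.trans ?_ (and_iff_right hI.1).symm
  exact exists_congr fun y => and_congr_right fun _ => mem_rowCone_iff hI.1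

theorem measurableSet_shadowPath (b : Fin n → ℝ) (c c' : EuclideanSpace ℝ (Fin d))
    (I : IndexSet n d) :
    MeasurableSet {p : (Fin n → Fin d → ℝ) × EuclideanSpace ℝ (Fin d) |
      I ∈ shadowPath (Matrix.of p.1) b (c + p.2) (c' + p.2)} := by
  simp only [shadowPath_eq, ← gapBases_zero]
  exact ((measurableSet_gapBases b 0 I).preimage measurable_fst).inter
    (measurableSet_multiplierBases c c' 0 I)

/-! ### Genericity -/

/-- The multiplier of the row `i` as a linear functional of the objective. -/
def multiplierFunctional (A : Matrix (Fin n) (Fin d) ℝ) (I : IndexSet n d) (i : Fin n) :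
    EuclideanSpace ℝ (Fin d) →ₗ[ℝ] ℝ where
  toFun y := multipliers A I y.ofLp i
  map_add' y y' := by rw [WithLp.ofLp_add, multipliers_add]
  map_smul' t y := by rw [WithLp.ofLp_smul, multipliers_smul]; rfl

theorem multiplierFunctional_row {A : Matrix (Fin n) (Fin d) ℝ} {I : IndexSet n d}
    (hI : IsUnit (subMatrix A I)) {i : Fin n} (hi : i ∈ I.1) (j : Fin n) :
    multiplierFunctional A I j (WithLp.toLp 2 (A i)) = if j = i then 1 else 0 := by
  have h := eq_multipliers hI (w := Pi.single i 1) fun k hk => by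
    rw [Pi.single_eq_of_ne]
    rintro rfl
    exact hk hi
  rw [Matrix.single_one_vecMul] at h
  exact (congrFun h j).symm.trans (by rw [Pi.single_apply])

theorem measurable_multiplierFunctional (I : IndexSet n d) (i : Fin n)
    {y : (Fin n → Fin d → ℝ) × EuclideanSpace ℝ (Fin d) → EuclideanSpace ℝ (Fin d)}
    (hy : Measurable y) :
    Measurable fun p : (Fin n → Fin d → ℝ) × EuclideanSpace ℝ (Fin d) =>
      multiplierFunctional (Matrix.of p.1) I i (y p) := by
  by_cases hi : i ∈ I.1
  · obtain ⟨k, rfl⟩ := (mem_iff_exists_orderEmbOfFin I).1 hi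
    have h : ∀ p : (Fin n → Fin d → ℝ) × EuclideanSpace ℝ (Fin d),
        multiplierFunctional (Matrix.of p.1) I (I.1.orderEmbOfFin I.2 k) (y p) =
          ((y p).ofLp ᵥ* (subMatrix (Matrix.of p.1) I)⁻¹) k := fun p =>
      multipliers_orderEmbOfFin _ I _ k
    simp only [h]
    exact measurable_vecMul_inv_subMatrix I hy k
  · have h : ∀ p : (Fin n → Fin d → ℝ) × EuclideanSpace ℝ (Fin d),
        multiplierFunctional (Matrix.of p.1) I i (y p) = 0 := fun p => multipliers_of_notMem hi _
    simp only [h]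
    exact measurable_const

/-- Eliminating `t` from two vanishing affine multipliers leaves a condition without a parameter.
The disjunction in `h3` excludes zero slopes, for which that condition is trivial. -/
theorem genericSegment_of_forall {A : Matrix (Fin n) (Fin d) ℝ}
    (h1 : ∀ I : IndexSet n d, ∀ i ∈ I.1, IsUnit (subMatrix A I) → multiplierFunctional A I i c ≠ 0)
    (h2 : ∀ I : IndexSet n d, ∀ i ∈ I.1, IsUnit (subMatrix A I) →
      multiplierFunctional A I i c' ≠ 0)
    (h3 : ∀ I : IndexSet n d, ∀ i ∈ I.1, ∀ k ∈ I.1, i ≠ k → IsUnit (subMatrix A I) →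
      ¬((multiplierFunctional A I i (c' - c) ≠ 0 ∨ multiplierFunctional A I k (c' - c) ≠ 0) ∧
        multiplierFunctional A I k (c' - c) * multiplierFunctional A I i c =
          multiplierFunctional A I i (c' - c) * multiplierFunctional A I k c)) :
    GenericSegment A c c' := by
  refine ⟨fun t I hI i hi k hk hik hi0 hk0 => ?_, fun I hI i hi => h1 I i hi hI,
    fun I hI i hi => h2 I i hi hI⟩
  rw [multipliers_objective] at hi0 hk0
  change multiplierFunctional A I i c + t * multiplierFunctional A I i (c' - c) = 0 at hi0
  change multiplierFunctional A I k c + t * multiplierFunctional A I k (c' - c) = 0 at hk0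
  refine h3 I i hi k hk hik hI ⟨?_, ?_⟩
  · left
    intro h
    rw [h, mul_zero, add_zero] at hi0
    exact h1 I i hi hI hi0
  · linear_combination multiplierFunctional A I k (c' - c) * hi0 -
      multiplierFunctional A I i (c' - c) * hk0

theorem ae_prod_of_forall_ae {α β : Type*} [MeasurableSpace α] [MeasurableSpace β]
    (μ : Measure α) (ν : Measure β) [SFinite μ] [SFinite ν] {p : α × β → Prop}
    (hp : MeasurableSet {x | p x}) (h : ∀ a, ∀ᵐ y ∂ν, p (a, y)) : ∀ᵐ x ∂μ.prod ν, p x :=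
  (Measure.ae_prod_iff_ae_ae hp).2 (Filter.Eventually.of_forall h)

/-- For fixed `A`, the shift does not change `c' - c`, so each bad event puts `Z` on a level set of
a nonzero linear functional. There are finitely many such events. -/
theorem ae_genericSegment (μ : Measure (Fin n → Fin d → ℝ)) [SFinite μ]
    (f : EuclideanSpace ℝ (Fin d) → ℝ) [SFinite (shiftLaw f)] (c c' : EuclideanSpace ℝ (Fin d)) :
    ∀ᵐ p ∂μ.prod (shiftLaw f), GenericSegment (Matrix.of p.1) (c + p.2) (c' + p.2) := by
  have hU : ∀ I : IndexSet n d,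
      MeasurableSet {p : (Fin n → Fin d → ℝ) × EuclideanSpace ℝ (Fin d) |
        IsUnit (subMatrix (Matrix.of p.1) I)} := fun I =>
    (measurableSet_isUnit_subMatrix I).preimage measurable_fst
  have hreg : ∀ (e : EuclideanSpace ℝ (Fin d)) (I : IndexSet n d), ∀ i ∈ I.1,
      ∀ᵐ p ∂μ.prod (shiftLaw f), IsUnit (subMatrix (Matrix.of p.1) I) →
        multiplierFunctional (Matrix.of p.1) I i (e + p.2) ≠ 0 := by
    intro e I i hi
    refine ae_prod_of_forall_ae _ _ ?_ fun a => ?_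
    · exact measurableSet_setOfPred.2 (Measurable.imp (measurableSet_setOfPred.1 (hU I))
        (measurableSet_setOfPred.1 (measurableSet_eq_fun
          (measurable_multiplierFunctional I i (by fun_prop)) measurable_const).compl))
    · by_cases hI : IsUnit (subMatrix (Matrix.of a) I)
      swap
      · exact Filter.Eventually.of_forall fun z h => absurd h hI
      have hne : multiplierFunctional (Matrix.of a) I i ≠ 0 := fun h => by
        have := multiplierFunctional_row hI hi i
        rw [h, if_pos rfl] at this
        exact zero_ne_one this
      have h0 := shiftLaw_levelSet f _ hne (-multiplierFunctional (Matrix.of a) I i e)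
      filter_upwards [measure_eq_zero_iff_ae_notMem.1 h0] with z hz _ h
      rw [map_add] at h
      exact hz (eq_neg_of_add_eq_zero_right h)
  have hpair : ∀ (I : IndexSet n d), ∀ i ∈ I.1, ∀ k ∈ I.1, i ≠ k →
      ∀ᵐ p ∂μ.prod (shiftLaw f), IsUnit (subMatrix (Matrix.of p.1) I) →
        ¬((multiplierFunctional (Matrix.of p.1) I i (c' - c) ≠ 0 ∨
            multiplierFunctional (Matrix.of p.1) I k (c' - c) ≠ 0) ∧
          multiplierFunctional (Matrix.of p.1) I k (c' - c) *
              multiplierFunctional (Matrix.of p.1) I i (c + p.2) =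
            multiplierFunctional (Matrix.of p.1) I i (c' - c) *
              multiplierFunctional (Matrix.of p.1) I k (c + p.2)) := by
    intro I i hi k hk hik
    have hm : ∀ i, Measurable fun p : (Fin n → Fin d → ℝ) × EuclideanSpace ℝ (Fin d) =>
        multiplierFunctional (Matrix.of p.1) I i (c' - c) := fun i =>
      measurable_multiplierFunctional I i measurable_const
    have hm' : ∀ i, Measurable fun p : (Fin n → Fin d → ℝ) × EuclideanSpace ℝ (Fin d) =>
        multiplierFunctional (Matrix.of p.1) I i (c + p.2) := fun i =>
      measurable_multiplierFunctional I i (by fun_prop)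
    refine ae_prod_of_forall_ae _ _ ?_ fun a => ?_
    · refine measurableSet_setOfPred.2 (Measurable.imp (measurableSet_setOfPred.1 (hU I))
        (measurableSet_setOfPred.1 (MeasurableSet.compl (MeasurableSet.inter
          (MeasurableSet.union ?_ ?_) ?_))))
      · exact (measurableSet_eq_fun (hm i) measurable_const).compl
      · exact (measurableSet_eq_fun (hm k) measurable_const).compl
      · exact measurableSet_eq_fun ((hm k).mul (hm' i)) ((hm i).mul (hm' k))
    · by_cases hI : IsUnit (subMatrix (Matrix.of a) I)
      swap
      · exact Filter.Eventually.of_forall fun z h => absurd h hI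
      by_cases hβ : multiplierFunctional (Matrix.of a) I i (c' - c) ≠ 0 ∨
          multiplierFunctional (Matrix.of a) I k (c' - c) ≠ 0
      swap
      · exact Filter.Eventually.of_forall fun z _ h => hβ h.1
      set l := multiplierFunctional (Matrix.of a) I k (c' - c) •
          multiplierFunctional (Matrix.of a) I i -
        multiplierFunctional (Matrix.of a) I i (c' - c) •
          multiplierFunctional (Matrix.of a) I k with hl
      -- Evaluating `l` at rows `i` and `k` gives the two slopes up to sign, and one of them is
      -- nonzero.
      have hne : l ≠ 0 := fun h => by
        have e1 := LinearMap.congr_fun h (WithLp.toLp 2 (Matrix.of a i))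
        have e2 := LinearMap.congr_fun h (WithLp.toLp 2 (Matrix.of a k))
        simp only [hl, LinearMap.sub_apply, LinearMap.smul_apply, multiplierFunctional_row hI hi,
          multiplierFunctional_row hI hk, if_neg hik, if_neg hik.symm, if_true, smul_eq_mul,
          mul_one, mul_zero, sub_zero, zero_sub, LinearMap.zero_apply, neg_eq_zero] at e1 e2
        exact hβ.elim (fun h => h e2) fun h => h e1
      have h0 := shiftLaw_levelSet f l hne (-l c)
      filter_upwards [measure_eq_zero_iff_ae_notMem.1 h0] with z hz _ h
      refine hz (eq_neg_of_add_eq_zero_right ?_)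
      rw [← map_add]
      simp only [hl, LinearMap.sub_apply, LinearMap.smul_apply, smul_eq_mul]
      linear_combination h.2
  have h1 : ∀ᵐ p ∂μ.prod (shiftLaw f), ∀ I : IndexSet n d, ∀ i ∈ I.1,
      IsUnit (subMatrix (Matrix.of p.1) I) →
        multiplierFunctional (Matrix.of p.1) I i (c + p.2) ≠ 0 := by
    simp only [ae_all_iff]
    exact hreg c
  have h2 : ∀ᵐ p ∂μ.prod (shiftLaw f), ∀ I : IndexSet n d, ∀ i ∈ I.1,
      IsUnit (subMatrix (Matrix.of p.1) I) →
        multiplierFunctional (Matrix.of p.1) I i (c' + p.2) ≠ 0 := by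
    simp only [ae_all_iff]
    exact hreg c'
  have h3 := fun I : IndexSet n d => fun i => fun hi : i ∈ I.1 => fun k => fun hk : k ∈ I.1 =>
    fun hik : i ≠ k => hpair I i hi k hk hik
  simp only [← ae_all_iff] at h3
  filter_upwards [h1, h2, h3] with p hp1 hp2 hp3
  refine genericSegment_of_forall hp1 hp2 fun I i hi k hk hik hI => ?_
  rw [add_sub_add_right_eq_sub]
  exact hp3 I i hi k hk hik hI

end

noncomputable section

variable {n d : ℕ} {b : Fin n → ℝ} {c c' : EuclideanSpace ℝ (Fin d)}

/-! ### Resampling the rows outside a basis -/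

/-- The family that agrees with `a` on `I` and with `a'` outside `I`. -/
def mix {ι R : Type*} [DecidableEq ι] (I : Finset ι) (a a' : ι → R) : ι → R :=
  fun i => if i ∈ I then a i else a' i

theorem measurePreserving_mix {ι R : Type*} [Fintype ι] [DecidableEq ι] [MeasurableSpace R]
    (ρ : ι → Measure R) [∀ i, IsProbabilityMeasure (ρ i)] (I : Finset ι) :
    MeasurePreserving (fun p : (ι → R) × (ι → R) => mix I p.1 p.2)
      ((Measure.pi ρ).prod (Measure.pi ρ)) (Measure.pi ρ) := by
  have hm : Measurable fun p : (ι → R) × (ι → R) => mix I p.1 p.2 := by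
    refine measurable_pi_lambda _ fun i => ?_
    unfold mix
    split_ifs <;> fun_prop
  refine ⟨hm, (Measure.pi_eq fun s hs => ?_).symm⟩
  rw [Measure.map_apply hm (MeasurableSet.univ_pi hs)]
  have h : (fun p : (ι → R) × (ι → R) => mix I p.1 p.2) ⁻¹' Set.univ.pi s =
      (Set.univ.pi fun i => if i ∈ I then s i else Set.univ) ×ˢ
        (Set.univ.pi fun i => if i ∈ I then Set.univ else s i) := by
    ext p
    simp only [Set.mem_preimage, Set.mem_univ_pi, Set.mem_prod, ← forall_and]
    refine forall_congr' fun i => ?_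
    by_cases hi : i ∈ I <;> simp [mix, hi]
  rw [h, Measure.prod_prod, Measure.pi_pi, Measure.pi_pi, ← Finset.prod_mul_distrib]
  refine Finset.prod_congr rfl fun i _ => ?_
  by_cases hi : i ∈ I <;> simp [hi]

/-- Fubini: an estimate that holds conditionally on the coordinates in `I` holds unconditionally. -/
theorem measure_le_of_mix_le {ι R : Type*} [Fintype ι] [DecidableEq ι] [MeasurableSpace R]
    (ρ : ι → Measure R) [∀ i, IsProbabilityMeasure (ρ i)] (I : Finset ι) {S T : Set (ι → R)}
    (hS : MeasurableSet S) (hT : MeasurableSet T) (κ ε : ℝ≥0∞)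
    (h : ∀ a, Measure.pi ρ {a' | mix I a a' ∈ S} ≤ κ * Measure.pi ρ {a' | mix I a a' ∈ T} + ε) :
    Measure.pi ρ S ≤ κ * Measure.pi ρ T + ε := by
  have hmp := measurePreserving_mix ρ I
  have key : ∀ U : Set (ι → R), MeasurableSet U →
      Measure.pi ρ U = ∫⁻ a, Measure.pi ρ {a' | mix I a a' ∈ U} ∂Measure.pi ρ := fun U hU => by
    rw [← hmp.measure_preimage hU.nullMeasurableSet, Measure.prod_apply (hmp.measurable hU)]
    rfl
  have hmeas : Measurable fun a => Measure.pi ρ {a' | mix I a a' ∈ T} :=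
    measurable_measure_prodMk_left (ν := Measure.pi ρ) (hmp.measurable hT)
  rw [key S hS, key T hT, ← lintegral_const_mul _ hmeas]
  refine (lintegral_mono h).trans_eq ?_
  rw [lintegral_add_right _ measurable_const, lintegral_const, measure_univ, mul_one]

theorem subMatrix_mix (I : IndexSet n d) (a a' : Fin n → Fin d → ℝ) :
    subMatrix (Matrix.of (mix I.1 a a')) I = subMatrix (Matrix.of a) I := by
  ext k l
  simp [subMatrix, mix]

theorem basicSolution_mix (I : IndexSet n d) (a a' : Fin n → Fin d → ℝ) :
    basicSolution (Matrix.of (mix I.1 a a')) b I = basicSolution (Matrix.of a) b I := by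
  rw [basicSolution, subMatrix_mix, basicSolution]

theorem mem_multiplierBases_mix {I : IndexSet n d} {a a' : Fin n → Fin d → ℝ} {m : ℝ} :
    I ∈ multiplierBases (Matrix.of (mix I.1 a a')) c c' m ↔
      I ∈ multiplierBases (Matrix.of a) c c' m := by
  rw [mem_multiplierBases_iff, mem_multiplierBases_iff, subMatrix_mix]

theorem mulVec_mix {I : IndexSet n d} (a a' : Fin n → Fin d → ℝ) {j : Fin n} (hj : j ∉ I.1)
    (x : Fin d → ℝ) : (Matrix.of (mix I.1 a a') *ᵥ x) j = a' j ⬝ᵥ x := by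
  simp [Matrix.mulVec, mix, hj]

theorem mem_gapBases_iff {A : Matrix (Fin n) (Fin d) ℝ} {I : IndexSet n d} {g : ℝ} (hg : 0 ≤ g) :
    I ∈ gapBases A b g ↔ IsUnit (subMatrix A I) ∧ ∀ j ∉ I.1,
      (A *ᵥ (basicSolution A b I).ofLp) j ≤ b j - g * ‖basicSolution A b I‖ := by
  refine ⟨fun h => ⟨h.1.1, h.2⟩, fun h => ⟨⟨h.1, fun j => ?_⟩, h.2⟩⟩
  by_cases hj : j ∈ I.1
  · exact (mulVec_basicSolution h.1 hj).le
  · exact (h.2 j hj).trans (sub_le_self _ (mul_nonneg hg (norm_nonneg _)))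

theorem mem_gapBases_mix {I : IndexSet n d} {a a' : Fin n → Fin d → ℝ} {g : ℝ} (hg : 0 ≤ g) :
    I ∈ gapBases (Matrix.of (mix I.1 a a')) b g ↔ IsUnit (subMatrix (Matrix.of a) I) ∧
      ∀ j ∉ I.1, a' j ⬝ᵥ (basicSolution (Matrix.of a) b I).ofLp ≤
        b j - g * ‖basicSolution (Matrix.of a) b I‖ := by
  rw [mem_gapBases_iff hg, subMatrix_mix, basicSolution_mix]
  refine and_congr_right fun _ => forall_congr' fun j => forall_congr' fun hj => ?_
  rw [mulVec_mix a a' hj]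

/-- The law of a matrix with independent Gaussian entries of variance `v` and mean `Abar`. -/
def matrixLaw (v : NNReal) (Abar : Fin n → Fin d → ℝ) : Measure (Fin n → Fin d → ℝ) :=
  Measure.pi fun i => rowLaw v (Abar i)

instance (v : NNReal) (Abar : Fin n → Fin d → ℝ) :
    IsProbabilityMeasure (matrixLaw v Abar) := by
  unfold matrixLaw
  infer_instance

/-! ### The gap -/

theorem matrixLaw_halfspaces {σ : ℝ} (hσ : 0 < σ) (Abar : Fin n → Fin d → ℝ)
    (I : IndexSet n d) {x : Fin d → ℝ} (hx : x ≠ 0) (t : Fin n → ℝ) :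
    (matrixLaw (σ ^ 2).toNNReal Abar).real {a' | ∀ j ∉ I.1, a' j ⬝ᵥ x ≤ t j} =
      ∏ j ∈ I.1ᶜ, gaussianCdf ((t j - Abar j ⬝ᵥ x) / (σ * ‖WithLp.toLp 2 x‖)) := by
  have h : {a' : Fin n → Fin d → ℝ | ∀ j ∉ I.1, a' j ⬝ᵥ x ≤ t j} =
      Set.univ.pi fun j => if j ∈ I.1 then Set.univ else {r | r ⬝ᵥ x ≤ t j} := by
    ext a'
    simp only [Set.mem_univ_pi, Set.mem_ofPred_eq]
    refine forall_congr' fun j => ?_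
    by_cases hj : j ∈ I.1 <;> simp [hj]
  rw [h, measureReal_def, matrixLaw, Measure.pi_pi, ENNReal.toReal_prod,
    ← Finset.prod_mul_prod_compl I.1, Finset.prod_eq_one, one_mul]
  · refine Finset.prod_congr rfl fun j hj => ?_
    rw [if_neg (Finset.mem_compl.1 hj), ← rowLaw_halfspace hσ _ hx]
    rfl
  · intro j hj
    rw [if_pos hj, measure_univ, ENNReal.toReal_one]

/-- The gap is relative to `‖x‖`, as is the standard deviation of a row applied to `x`. Hence it
shifts each standardized threshold by exactly `h`. For `x = 0` the gap condition is feasibility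
itself. -/
theorem matrixLaw_halfspaces_sub_le {σ h L : ℝ} (hσ : 0 < σ) (Abar : Fin n → Fin d → ℝ)
    (I : IndexSet n d) (x : EuclideanSpace ℝ (Fin d)) (hL : 1 / 2 ≤ L)
    (hh : 0 ≤ h) (hhK : h * √(2 * L) ≤ 1 / 400) (hhL : h * √(2 * L) * L ≤ 1 / 400)
    (hn : n * Real.exp (-L) ≤ 1) :
    matrixLaw (σ ^ 2).toNNReal Abar ({a' | ∀ j ∉ I.1, a' j ⬝ᵥ x.ofLp ≤ b j} \
        {a' | ∀ j ∉ I.1, a' j ⬝ᵥ x.ofLp ≤ b j - σ * h * ‖x‖}) ≤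
      ENNReal.ofReal (1 / 10) * matrixLaw (σ ^ 2).toNNReal Abar
        {a' | ∀ j ∉ I.1, a' j ⬝ᵥ x.ofLp ≤ b j} + ENNReal.ofReal (Real.exp (-L)) := by
  by_cases hx : x.ofLp = 0
  · have hx' : x = 0 := WithLp.ofLp_injective 2 hx
    simp [hx']
  have hxn : 0 < ‖x‖ := norm_pos_iff.2 fun h0 => hx (by rw [h0]; rfl)
  have hms : ∀ t : Fin n → ℝ, MeasurableSet {a' : Fin n → Fin d → ℝ |
      ∀ j ∉ I.1, a' j ⬝ᵥ x.ofLp ≤ t j} := fun t => by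
    refine measurableSet_setOfPred.2 (Measurable.forall fun j => Measurable.imp measurable_const
      (measurableSet_setOfPred.1 (measurableSet_le ?_ measurable_const)))
    exact (measurable_dotProduct_const x.ofLp).comp (measurable_pi_apply j)
  have hsub : {a' : Fin n → Fin d → ℝ | ∀ j ∉ I.1, a' j ⬝ᵥ x.ofLp ≤ b j - σ * h * ‖x‖} ⊆
      {a' | ∀ j ∉ I.1, a' j ⬝ᵥ x.ofLp ≤ b j} := fun a' ha' j hj =>
    (ha' j hj).trans (sub_le_self _ (by positivity))
  rw [← ofReal_measureReal, ← ofReal_measureReal, ← ENNReal.ofReal_mul (by norm_num),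
    ← ENNReal.ofReal_add (by positivity) (by positivity)]
  refine ENNReal.ofReal_le_ofReal ?_
  rw [measureReal_sdiff hsub (hms _), matrixLaw_halfspaces hσ Abar I hx,
    matrixLaw_halfspaces hσ Abar I hx]
  have hcard : (I.1ᶜ.card : ℝ) * Real.exp (-L) ≤ 1 := by
    refine le_trans (mul_le_mul_of_nonneg_right ?_ (Real.exp_pos _).le) hn
    exact_mod_cast (Finset.card_le_univ _).trans_eq (Fintype.card_fin n)
  have key := prod_gaussianCdf_sub_le I.1ᶜ
    (fun j => (b j - Abar j ⬝ᵥ x.ofLp) / (σ * ‖x‖)) hL hh hhK hhL hcard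
  have heq : ∀ j, (b j - σ * h * ‖x‖ - Abar j ⬝ᵥ x.ofLp) / (σ * ‖x‖) =
      (b j - Abar j ⬝ᵥ x.ofLp) / (σ * ‖x‖) - h := fun j => by
    field_simp
    ring
  simp only [WithLp.toLp_ofLp, heq]
  exact key

/-- Given the rows in `I`, the basic solution and the multipliers are fixed, and the other rows
enter only through their half-space conditions. -/
theorem matrixLaw_shadowPath_diff_gapBases_le {σ h L : ℝ} (hσ : 0 < σ)
    (Abar : Fin n → Fin d → ℝ) (c c' : EuclideanSpace ℝ (Fin d)) (I : IndexSet n d)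
    (hL : 1 / 2 ≤ L) (hh : 0 ≤ h) (hhK : h * √(2 * L) ≤ 1 / 400)
    (hhL : h * √(2 * L) * L ≤ 1 / 400) (hn : n * Real.exp (-L) ≤ 1) :
    matrixLaw (σ ^ 2).toNNReal Abar {a | I ∈ shadowPath (Matrix.of a) b c c' ∧
        I ∉ gapBases (Matrix.of a) b (σ * h)} ≤
      ENNReal.ofReal (1 / 10) * matrixLaw (σ ^ 2).toNNReal Abar
        {a | I ∈ shadowPath (Matrix.of a) b c c'} + ENNReal.ofReal (Real.exp (-L)) := by
  have hP : MeasurableSet {a : Fin n → Fin d → ℝ | I ∈ shadowPath (Matrix.of a) b c c'} := by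
    have h1 := (measurableSet_shadowPath b c c' I).preimage
      (measurable_id.prodMk (measurable_const (a := (0 : EuclideanSpace ℝ (Fin d)))))
    simpa using h1
  refine measure_le_of_mix_le _ I.1 (hP.inter (measurableSet_gapBases b _ I).compl) hP _ _
    fun a => ?_
  have hgap := fun a' => mem_gapBases_mix (b := b) (I := I) (a := a) (a' := a')
    (mul_nonneg hσ.le hh)
  have hfeas := fun a' => mem_gapBases_mix (b := b) (I := I) (a := a) (a' := a') le_rfl
  simp only [Set.mem_ofPred_eq, Set.mem_inter_iff, Set.mem_compl_iff, shadowPath_eq,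
    ← gapBases_zero, mem_multiplierBases_mix, hgap, hfeas, zero_mul, sub_zero]
  by_cases hU : IsUnit (subMatrix (Matrix.of a) I) ∧ I ∈ multiplierBases (Matrix.of a) c c' 0
  · simp only [hU, true_and, and_true]
    exact matrixLaw_halfspaces_sub_le hσ Abar I (basicSolution (Matrix.of a) b I) hL hh hhK hhL hn
  · have hempty : {a' : Fin n → Fin d → ℝ | ((IsUnit (subMatrix (Matrix.of a) I) ∧
        ∀ j ∉ I.1, a' j ⬝ᵥ (basicSolution (Matrix.of a) b I).ofLp ≤ b j) ∧
          I ∈ multiplierBases (Matrix.of a) c c' 0) ∧ ¬(IsUnit (subMatrix (Matrix.of a) I) ∧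
        ∀ j ∉ I.1, a' j ⬝ᵥ (basicSolution (Matrix.of a) b I).ofLp ≤
          b j - σ * h * ‖basicSolution (Matrix.of a) b I‖)} = ∅ := by
      ext a'
      simp only [Set.mem_ofPred_eq, Set.mem_empty_iff_false, iff_false]
      exact fun h => hU ⟨h.1.1.1, h.1.2⟩
    refine le_trans (le_of_eq ?_) zero_le
    exact (congrArg _ hempty).trans measure_empty

/-! ### Nondegeneracy -/

/-- Given the rows in `I`, an independent row `j` is tight at a nonzero `x_I` with probability zero.
The case `x_I = 0` is where the assumption on `b` is needed. -/
theorem ae_nondegenerate {σ : ℝ} (hσ : 0 < σ) (Abar : Fin n → Fin d → ℝ)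
    (hb : {i | b i = 0}.ncard ≤ d ∨ ∃ i, b i < 0) :
    ∀ᵐ a ∂matrixLaw (σ ^ 2).toNNReal Abar, Nondegenerate (Matrix.of a) b := by
  have key : ∀ (I : IndexSet n d), ∀ j ∉ I.1, ∀ᵐ a ∂matrixLaw (σ ^ 2).toNNReal Abar,
      ¬(I ∈ feasibleBases (Matrix.of a) b ∧
        (Matrix.of a *ᵥ (basicSolution (Matrix.of a) b I).ofLp) j = b j) := by
    intro I j hj
    have hF : MeasurableSet {a : Fin n → Fin d → ℝ | I ∈ feasibleBases (Matrix.of a) b} := by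
      simp only [← gapBases_zero]
      exact measurableSet_gapBases b 0 I
    have hS : MeasurableSet {a : Fin n → Fin d → ℝ | I ∈ feasibleBases (Matrix.of a) b ∧
        (Matrix.of a *ᵥ (basicSolution (Matrix.of a) b I).ofLp) j = b j} :=
      hF.inter (measurableSet_eq_fun (measurable_mulVec_basicSolution b I j) measurable_const)
    suffices h : matrixLaw (σ ^ 2).toNNReal Abar {a : Fin n → Fin d → ℝ |
        I ∈ feasibleBases (Matrix.of a) b ∧
        (Matrix.of a *ᵥ (basicSolution (Matrix.of a) b I).ofLp) j = b j} = 0 from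
      measure_eq_zero_iff_ae_notMem.1 h
    refine le_antisymm ?_ zero_le
    refine (measure_le_of_mix_le (fun i => rowLaw (σ ^ 2).toNNReal (Abar i)) I.1 hS
      MeasurableSet.empty 0 0 fun a => ?_).trans_eq (by simp)
    rw [zero_mul, add_zero, nonpos_iff_eq_zero]
    simp only [Set.mem_ofPred_eq, basicSolution_mix, mulVec_mix _ _ hj]
    by_cases hx : (basicSolution (Matrix.of a) b I).ofLp = 0
    · have hempty : {a' : Fin n → Fin d → ℝ | I ∈ feasibleBases (Matrix.of (mix I.1 a a')) b ∧
          a' j ⬝ᵥ (basicSolution (Matrix.of a) b I).ofLp = b j} = ∅ := by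
        ext a'
        simp only [Set.mem_ofPred_eq, Set.mem_empty_iff_false, iff_false]
        rintro ⟨hfeas, hbj⟩
        rw [hx, dotProduct_zero] at hbj
        have hval : ∀ i, (Matrix.of (mix I.1 a a') *ᵥ
            (basicSolution (Matrix.of (mix I.1 a a')) b I).ofLp) i = 0 := fun i => by
          rw [basicSolution_mix, hx, Matrix.mulVec_zero]
          rfl
        rcases hb with hb | ⟨i, hi⟩
        -- Tightness at the origin would make `b` vanish on the `d + 1` indices of `I` and `j`.
        · have hsub : ((insert j I.1 : Finset (Fin n)) : Set (Fin n)) ⊆ {i | b i = 0} := by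
            intro i hi
            rcases Finset.mem_insert.1 (Finset.mem_coe.1 hi) with rfl | hi
            · exact hbj.symm
            · exact (mulVec_basicSolution hfeas.1 hi).symm.trans (hval i)
          have hcard := Set.ncard_le_ncard hsub (Set.toFinite _)
          rw [Set.ncard_coe_finset, Finset.card_insert_of_notMem hj, I.2] at hcard
          omega
        · have := hfeas.2 i
          rw [hval i] at this
          exact absurd this (not_le.2 hi)
      rw [hempty, measure_empty]
    · have h0 := rowLaw_hyperplane hσ (Abar j) hx (b j)
      have h1 := (measurePreserving_eval (fun i => rowLaw (σ ^ 2).toNNReal (Abar i))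
        j).quasiMeasurePreserving.preimage_null h0
      exact measure_mono_null (fun a' ha' => ha'.2) h1
  have h2 : ∀ᵐ a ∂matrixLaw (σ ^ 2).toNNReal Abar, ∀ (I : IndexSet n d), ∀ j ∉ I.1,
      ¬(I ∈ feasibleBases (Matrix.of a) b ∧
        (Matrix.of a *ᵥ (basicSolution (Matrix.of a) b I).ofLp) j = b j) := by
    simp only [ae_all_iff]
    exact key
  filter_upwards [h2] with a ha I hI j hj
  exact (hI.2 j).lt_of_ne fun h => ha I j hj ⟨hI, h⟩

/-! ### The multipliers -/

/-- The vector `w` has all multipliers equal to `m`. Both ends of the segment move with `z`, so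
translating by `w` turns nonnegative multipliers into multipliers at least `m`, at the cost of a
factor `e^{-‖w‖} ≥ e^{-2dm}`. -/
theorem shiftLaw_multiplierBases_diff_le {f : EuclideanSpace ℝ (Fin d) → ℝ}
    (hf : IsLogLipschitz 1 f) [IsFiniteMeasure (shiftLaw f)] (c c' : EuclideanSpace ℝ (Fin d))
    (a : Fin n → Fin d → ℝ) (ha : ∀ i, ‖WithLp.toLp 2 (a i)‖ ≤ 2) (I : IndexSet n d) {m : ℝ}
    (hm : 0 ≤ m) :
    shiftLaw f {z | I ∈ multiplierBases (Matrix.of a) (c + z) (c' + z) 0 ∧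
        I ∉ multiplierBases (Matrix.of a) (c + z) (c' + z) m} ≤
      ENNReal.ofReal (1 - Real.exp (-(m * (2 * d)))) *
        shiftLaw f {z | I ∈ multiplierBases (Matrix.of a) (c + z) (c' + z) 0} := by
  by_cases hU : IsUnit (subMatrix (Matrix.of a) I)
  swap
  · have : {z : EuclideanSpace ℝ (Fin d) | I ∈ multiplierBases (Matrix.of a) (c + z) (c' + z) 0 ∧
        I ∉ multiplierBases (Matrix.of a) (c + z) (c' + z) m} = ∅ := by
      ext z
      simp only [Set.mem_ofPred_eq, Set.mem_empty_iff_false, iff_false]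
      exact fun h => hU h.1.1
    rw [this, measure_empty]
    exact zero_le
  have hdet := (Matrix.isUnit_iff_isUnit_det _).1 hU
  set w : EuclideanSpace ℝ (Fin d) :=
    WithLp.toLp 2 ((fun _ => m) ᵥ* subMatrix (Matrix.of a) I) with hw
  have hwinv : w.ofLp ᵥ* (subMatrix (Matrix.of a) I)⁻¹ = fun _ => m := by
    rw [hw, Matrix.vecMul_vecMul, Matrix.mul_nonsing_inv _ hdet, Matrix.vecMul_one]
  have hwnorm : ‖w‖ ≤ m * (2 * d) := by
    have hsum : w = ∑ k, m • WithLp.toLp 2 (a (I.1.orderEmbOfFin I.2 k)) := by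
      apply WithLp.ofLp_injective 2
      ext l
      simp [hw, Matrix.vecMul, dotProduct, subMatrix]
    rw [hsum]
    refine (norm_sum_le _ _).trans ?_
    calc ∑ k : Fin d, ‖m • WithLp.toLp 2 (a (I.1.orderEmbOfFin I.2 k))‖
        ≤ ∑ _k : Fin d, m * 2 := Finset.sum_le_sum fun k _ => by
          rw [norm_smul, Real.norm_of_nonneg hm]
          exact mul_le_mul_of_nonneg_left (ha _) hm
      _ = m * (2 * d) := by
          rw [Finset.sum_const, Finset.card_univ, Fintype.card_fin, nsmul_eq_mul]
          ring
  have hmeas : ∀ m, MeasurableSet {z : EuclideanSpace ℝ (Fin d) |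
      I ∈ multiplierBases (Matrix.of a) (c + z) (c' + z) m} := fun m =>
    (measurableSet_multiplierBases c c' m I).preimage (measurable_const.prodMk measurable_id)
  have hmono : {z : EuclideanSpace ℝ (Fin d) |
        I ∈ multiplierBases (Matrix.of a) (c + z) (c' + z) m} ⊆
      {z | I ∈ multiplierBases (Matrix.of a) (c + z) (c' + z) 0} := by
    rintro z ⟨h1, y, hy, h2⟩
    exact ⟨h1, y, hy, fun k => hm.trans (h2 k)⟩
  have hshift : (fun z => z - w) ⁻¹' {z : EuclideanSpace ℝ (Fin d) |
      I ∈ multiplierBases (Matrix.of a) (c + z) (c' + z) 0} ⊆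
        {z | I ∈ multiplierBases (Matrix.of a) (c + z) (c' + z) m} := by
    intro z hz
    simp only [Set.mem_preimage, Set.mem_ofPred_eq, mem_multiplierBases_iff] at hz ⊢
    obtain ⟨-, t, ht, h⟩ := hz
    refine ⟨hU, t, ht, fun k => ?_⟩
    have h1 := h k
    rw [← add_sub_assoc, ← add_sub_assoc, sub_sub_sub_cancel_right, WithLp.ofLp_sub 2 (c + z),
      Matrix.sub_vecMul, hwinv, Pi.sub_apply] at h1
    linarith
  have h1 := (shiftLaw_translate_ge hf w (hmeas 0)).trans (measure_mono hshift)
  rw [← ofReal_measureReal, ← ofReal_measureReal (s := {z : EuclideanSpace ℝ (Fin d) |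
      I ∈ multiplierBases (Matrix.of a) (c + z) (c' + z) m}),
    ← ENNReal.ofReal_mul (Real.exp_pos _).le,
    ENNReal.ofReal_le_ofReal_iff measureReal_nonneg] at h1
  have hexp : Real.exp (-(m * (2 * d))) ≤ 1 := Real.exp_le_one_iff.2 (by
    rw [neg_nonpos]
    positivity)
  have h2 := mul_le_mul_of_nonneg_right (Real.exp_le_exp.2 (neg_le_neg hwnorm))
    (measureReal_nonneg (μ := shiftLaw f) (s := {z : EuclideanSpace ℝ (Fin d) |
      I ∈ multiplierBases (Matrix.of a) (c + z) (c' + z) 0}))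
  have h3 := measureReal_sdiff (μ := shiftLaw f) hmono (hmeas m)
  rw [← ofReal_measureReal, ← ofReal_measureReal (s := {z : EuclideanSpace ℝ (Fin d) |
      I ∈ multiplierBases (Matrix.of a) (c + z) (c' + z) 0}),
    ← ENNReal.ofReal_mul (sub_nonneg.2 hexp)]
  refine ENNReal.ofReal_le_ofReal (le_trans (le_of_eq h3) ?_)
  linarith

end

noncomputable section

variable {n d : ℕ} {b : Fin n → ℝ} {c c' : EuclideanSpace ℝ (Fin d)}

/-! ### Expected numbers of bases -/

theorem prod_measure_le_of_right_slices {α β : Type*} [MeasurableSpace α] [MeasurableSpace β]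
    (μ : Measure α) (ν : Measure β) [SFinite μ] [IsProbabilityMeasure ν] {S T : Set (α × β)}
    (hS : MeasurableSet S) (hT : MeasurableSet T) (κ ε : ℝ≥0∞)
    (h : ∀ y, μ {x | (x, y) ∈ S} ≤ κ * μ {x | (x, y) ∈ T} + ε) :
    μ.prod ν S ≤ κ * μ.prod ν T + ε := by
  have hmeas : Measurable fun y => μ {x | (x, y) ∈ T} := measurable_measure_prodMk_right hT
  have hT' : μ.prod ν T = ∫⁻ y, μ {x | (x, y) ∈ T} ∂ν := Measure.prod_apply_symm hT
  rw [Measure.prod_apply_symm hS, hT', ← lintegral_const_mul _ hmeas]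
  refine (lintegral_mono h).trans_eq ?_
  rw [lintegral_add_right _ measurable_const, lintegral_const, measure_univ, mul_one]

/-- Slices over the bad set `B` are bounded by `1`, so `B` contributes just its own measure. -/
theorem prod_measure_le_of_left_slices {α β : Type*} [MeasurableSpace α] [MeasurableSpace β]
    (μ : Measure α) (ν : Measure β) [SFinite μ] [IsProbabilityMeasure ν] {S T : Set (α × β)}
    {B : Set α} (hS : MeasurableSet S) (hT : MeasurableSet T) (hB : MeasurableSet B) (κ : ℝ≥0∞)
    (h : ∀ x ∉ B, ν {y | (x, y) ∈ S} ≤ κ * ν {y | (x, y) ∈ T}) :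
    μ.prod ν S ≤ κ * μ.prod ν T + μ B := by
  have hmeas : Measurable fun x => ν {y | (x, y) ∈ T} := measurable_measure_prodMk_left hT
  have hT' : μ.prod ν T = ∫⁻ x, ν {y | (x, y) ∈ T} ∂μ := Measure.prod_apply hT
  rw [Measure.prod_apply hS, hT', ← lintegral_const_mul _ hmeas, ← lintegral_indicator_one hB,
    ← lintegral_add_right _ (measurable_one.indicator hB)]
  refine lintegral_mono fun x => ?_
  by_cases hx : x ∈ B
  · rw [Set.indicator_of_mem hx]
    exact prob_le_one.trans le_add_self
  · exact (h x hx).trans le_self_add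

theorem ncard_eq_sum_indicator {V : Type*} [Fintype V] (S : Set V) :
    (S.ncard : ℝ≥0∞) = ∑ v, S.indicator 1 v := by
  classical
  rw [Set.ncard_eq_toFinset_card', Finset.card_eq_sum_ones, Nat.cast_sum, Nat.cast_one,
    ← Finset.sum_filter_add_sum_filter_not Finset.univ (· ∈ S), Finset.sum_congr rfl fun v hv =>
      Set.indicator_of_mem (Finset.mem_filter.1 hv).2 (1 : V → ℝ≥0∞),
    Finset.sum_eq_zero (s := Finset.univ.filter (· ∉ S)) fun v hv =>
      Set.indicator_of_notMem (Finset.mem_filter.1 hv).2 (1 : V → ℝ≥0∞), add_zero]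
  refine Finset.sum_congr ?_ fun _ _ => rfl
  ext v
  simp

theorem ncard_family_eq {α V : Type*} [Fintype V] (S : α → Set V) (x : α) :
    ((S x).ncard : ℝ≥0∞) = ∑ v, {x | v ∈ S x}.indicator (1 : α → ℝ≥0∞) x := by
  rw [ncard_eq_sum_indicator]
  refine Finset.sum_congr rfl fun v _ => ?_
  by_cases h : v ∈ S x
  · rw [Set.indicator_of_mem h, Set.indicator_of_mem (by exact h)]
    rfl
  · rw [Set.indicator_of_notMem h, Set.indicator_of_notMem (by exact h)]

theorem measurable_ncard {α V : Type*} [MeasurableSpace α] [Fintype V] {S : α → Set V}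
    (hS : ∀ v, MeasurableSet {x | v ∈ S x}) : Measurable fun x => ((S x).ncard : ℝ≥0∞) := by
  simp only [ncard_family_eq]
  exact Finset.measurable_fun_sum _ fun v _ => measurable_one.indicator (hS v)

theorem lintegral_ncard {α V : Type*} [MeasurableSpace α] [Fintype V] (μ : Measure α)
    {S : α → Set V} (hS : ∀ v, MeasurableSet {x | v ∈ S x}) :
    ∫⁻ x, ((S x).ncard : ℝ≥0∞) ∂μ = ∑ v, μ {x | v ∈ S x} := by
  simp only [ncard_family_eq]
  rw [lintegral_finsetSum _ fun v _ => measurable_one.indicator (hS v)]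
  exact Finset.sum_congr rfl fun v _ => lintegral_indicator_one (hS v)

theorem card_indexSet_mul_le (hn : 2 ≤ n) :
    (Fintype.card (IndexSet n d) : ℝ) * Real.exp (-(d * Real.log n)) ≤ 1 := by
  have h1 : Fintype.card (IndexSet n d) ≤ n ^ d := by
    refine (Fintype.card_finset_len d).le.trans ?_
    rw [Fintype.card_fin]
    exact Nat.choose_le_pow n d
  have hn0 : (0 : ℝ) < n := by positivity
  have h2 : Real.exp (-(d * Real.log n)) = ((n : ℝ) ^ d)⁻¹ := by
    rw [Real.exp_neg, mul_comm, ← Real.rpow_def_of_pos hn0, Real.rpow_natCast]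
  rw [h2, ← div_eq_mul_inv, div_le_one (by positivity)]
  exact_mod_cast h1

theorem half_le_mul_log (hn : 2 ≤ n) (hd : 1 ≤ d) : 1 / 2 ≤ d * Real.log n := by
  have h1 : Real.log 2 ≤ Real.log n := Real.log_le_log two_pos (by exact_mod_cast hn)
  have h2 := Real.log_two_gt_d9
  have h3 : (1 : ℝ) ≤ d := by exact_mod_cast hd
  nlinarith

theorem log_le_mul_log (hn : 2 ≤ n) (hd : 1 ≤ d) : Real.log n ≤ d * Real.log n :=
  le_mul_of_one_le_left (Real.log_nonneg (by exact_mod_cast one_le_two.trans hn))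
    (by exact_mod_cast hd)

theorem matrixLaw_long_row_le (hn : 2 ≤ n) (hd : 1 ≤ d) {σ : ℝ} (hσ : 0 < σ)
    (hσ' : σ ≤ 1 / (4 * √(d * Real.log n))) (Abar : Fin n → Fin d → ℝ)
    (hAbar : ∀ i, ‖WithLp.toLp 2 (Abar i)‖ ≤ 1) :
    matrixLaw (σ ^ 2).toNNReal Abar {a | ∃ i, 2 < ‖WithLp.toLp 2 (a i)‖} ≤
      ENNReal.ofReal (Real.exp (-(d * Real.log n))) := by
  obtain ⟨L, hLdef⟩ : ∃ L, L = d * Real.log n := ⟨_, rfl⟩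
  have hL : 1 / 2 ≤ L := hLdef ▸ half_le_mul_log hn hd
  have hn0 : (0 : ℝ) < n := by positivity
  rw [← hLdef] at hσ' ⊢
  have hrow : ∀ i, matrixLaw (σ ^ 2).toNNReal Abar {a | 2 < ‖WithLp.toLp 2 (a i)‖} ≤
      ENNReal.ofReal (√2 ^ d * Real.exp (-(1 / (4 * σ ^ 2)))) := fun i => by
    have hm : MeasurableSet {r : Fin d → ℝ | 2 < ‖WithLp.toLp 2 r‖} :=
      measurableSet_lt measurable_const (WithLp.measurable_toLp 2 (Fin d → ℝ)).norm
    have h1 := (measurePreserving_eval (fun i => rowLaw (σ ^ 2).toNNReal (Abar i))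
      i).measure_preimage hm.nullMeasurableSet
    refine (h1.trans_le ?_)
    rw [← ofReal_measureReal]
    exact ENNReal.ofReal_le_ofReal (rowLaw_norm_gt hσ (hAbar i))
  have hunion : {a : Fin n → Fin d → ℝ | ∃ i, 2 < ‖WithLp.toLp 2 (a i)‖} =
      ⋃ i, {a | 2 < ‖WithLp.toLp 2 (a i)‖} := by
    ext a
    simp
  rw [hunion]
  refine (measure_iUnion_fintype_le _ _).trans ((Finset.sum_le_sum fun i _ => hrow i).trans ?_)
  rw [Finset.sum_const, Finset.card_univ, Fintype.card_fin, nsmul_eq_mul,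
    ← ENNReal.ofReal_natCast, ← ENNReal.ofReal_mul hn0.le]
  refine ENNReal.ofReal_le_ofReal ?_
  -- The bound on `σ` yields a tail `e^{-4L}`. It beats the `n ≤ e^L` rows and the factor `√2 ^ d ≤
  -- n ^ d = e^L`.
  have hsq : 4 * L ≤ 1 / (4 * σ ^ 2) := by
    have hs : 0 < √L := Real.sqrt_pos.2 (by linarith)
    rw [le_div_iff₀ (by positivity)] at hσ' ⊢
    have h1 : (σ * (4 * √L)) ^ 2 ≤ 1 := pow_le_one₀ (by positivity) hσ'
    have h2 : √L ^ 2 = L := Real.sq_sqrt (by linarith)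
    calc 4 * L * (4 * σ ^ 2) = (σ * (4 * √L)) ^ 2 := by rw [mul_pow, mul_pow, h2]; ring
      _ ≤ 1 := h1
  have h2 : (n : ℝ) ≤ Real.exp L := by
    rw [← Real.exp_log hn0, Real.exp_le_exp, hLdef]
    exact log_le_mul_log hn hd
  have h3 : √2 ^ d ≤ Real.exp L := by
    have h4 : Real.exp L = (n : ℝ) ^ d := by
      rw [hLdef, mul_comm, ← Real.rpow_def_of_pos hn0, Real.rpow_natCast]
    rw [h4]
    refine pow_le_pow_left₀ (Real.sqrt_nonneg _) ?_ d
    have h5 : √2 ≤ 2 := Real.sqrt_le_iff.2 ⟨by norm_num, by norm_num⟩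
    exact h5.trans (by exact_mod_cast hn)
  calc (n : ℝ) * (√2 ^ d * Real.exp (-(1 / (4 * σ ^ 2))))
      ≤ Real.exp L * (Real.exp L * Real.exp (-(4 * L))) := by gcongr
    _ = Real.exp (-(2 * L)) := by
        rw [← Real.exp_add, ← Real.exp_add]
        ring_nf
    _ ≤ Real.exp (-L) := Real.exp_le_exp.2 (by linarith)

theorem gap_bounds {L h : ℝ} (hL : 1 / 2 ≤ L) (hh : h = 1 / (5000 * (L * √L))) :
    0 ≤ h ∧ h * √(2 * L) ≤ 1 / 400 ∧ h * √(2 * L) * L ≤ 1 / 400 := by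
  have hL0 : 0 < L := by linarith
  have hs : 0 < √L := Real.sqrt_pos.2 hL0
  have h2 : √2 ≤ 2 := Real.sqrt_le_iff.2 ⟨by norm_num, by norm_num⟩
  have e1 : h * √(2 * L) = √2 / (5000 * L) := by
    rw [hh, Real.sqrt_mul two_pos.le]
    field_simp
  have e2 : h * √(2 * L) * L = √2 / 5000 := by
    rw [e1]
    field_simp
  refine ⟨hh ▸ by positivity, ?_, ?_⟩
  · rw [e1, div_le_div_iff₀ (by positivity) (by norm_num)]
    linarith
  · rw [e2]
    linarith

theorem measurableSet_shadowPath_diff (b : Fin n → ℝ) (c c' : EuclideanSpace ℝ (Fin d)) (g m : ℝ)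
    (I : IndexSet n d) :
    MeasurableSet {p : (Fin n → Fin d → ℝ) × EuclideanSpace ℝ (Fin d) |
      I ∈ shadowPath (Matrix.of p.1) b (c + p.2) (c' + p.2) \ (gapBases (Matrix.of p.1) b g ∩
        multiplierBases (Matrix.of p.1) (c + p.2) (c' + p.2) m)} :=
  (measurableSet_shadowPath b c c' I).diff
    (((measurableSet_gapBases b g I).preimage measurable_fst).inter
      (measurableSet_multiplierBases c c' m I))

theorem prod_shadowPath_diff_gapBases_le (hn : 2 ≤ n) (hd : 1 ≤ d) {σ : ℝ} (hσ : 0 < σ)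
    (Abar : Fin n → Fin d → ℝ) (b : Fin n → ℝ) (c c' : EuclideanSpace ℝ (Fin d))
    (ν : Measure (EuclideanSpace ℝ (Fin d))) [IsProbabilityMeasure ν] {g : ℝ}
    (hg : g = σ * (1 / (5000 * (d * Real.log n * √(d * Real.log n))))) (I : IndexSet n d) :
    (matrixLaw (σ ^ 2).toNNReal Abar).prod ν
        {p | I ∈ shadowPath (Matrix.of p.1) b (c + p.2) (c' + p.2) ∧
          I ∉ gapBases (Matrix.of p.1) b g} ≤
      ENNReal.ofReal (1 / 10) * (matrixLaw (σ ^ 2).toNNReal Abar).prod ν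
        {p | I ∈ shadowPath (Matrix.of p.1) b (c + p.2) (c' + p.2)} +
          ENNReal.ofReal (Real.exp (-(d * Real.log n))) := by
  have hL : 1 / 2 ≤ d * Real.log n := half_le_mul_log hn hd
  obtain ⟨hh, hhK, hhL⟩ := gap_bounds hL rfl
  have hn0 : (0 : ℝ) < n := by positivity
  have hnL : n * Real.exp (-(d * Real.log n)) ≤ 1 := by
    rw [Real.exp_neg, ← div_eq_mul_inv, div_le_one (Real.exp_pos _)]
    exact (Real.exp_log hn0).symm.le.trans (Real.exp_le_exp.2 (log_le_mul_log hn hd))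
  have hG : MeasurableSet {p : (Fin n → Fin d → ℝ) × EuclideanSpace ℝ (Fin d) |
      I ∈ gapBases (Matrix.of p.1) b g} := (measurableSet_gapBases b g I).preimage measurable_fst
  have hP := measurableSet_shadowPath (n := n) b c c' I
  refine prod_measure_le_of_right_slices _ _ (hP.inter hG.compl) hP _ _ fun z => ?_
  rw [hg]
  exact matrixLaw_shadowPath_diff_gapBases_le hσ Abar (c + z) (c' + z) I hL hh hhK hhL hnL

theorem prod_shadowPath_diff_multiplierBases_le (hn : 2 ≤ n) (hd : 1 ≤ d) {σ : ℝ} (hσ : 0 < σ)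
    (hσ' : σ ≤ 1 / (4 * √(d * Real.log n))) (Abar : Fin n → Fin d → ℝ)
    (hAbar : ∀ i, ‖WithLp.toLp 2 (Abar i)‖ ≤ 1) (b : Fin n → ℝ)
    (c c' : EuclideanSpace ℝ (Fin d)) {f : EuclideanSpace ℝ (Fin d) → ℝ}
    (hf : IsLogLipschitz 1 f) [IsProbabilityMeasure (shiftLaw f)] {m : ℝ}
    (hm : m = Real.log (1 / 0.99) / (2 * d)) (I : IndexSet n d) :
    (matrixLaw (σ ^ 2).toNNReal Abar).prod (shiftLaw f)
        {p | I ∈ shadowPath (Matrix.of p.1) b (c + p.2) (c' + p.2) ∧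
          I ∉ multiplierBases (Matrix.of p.1) (c + p.2) (c' + p.2) m} ≤
      ENNReal.ofReal (1 / 100) * (matrixLaw (σ ^ 2).toNNReal Abar).prod (shiftLaw f)
        {p | I ∈ shadowPath (Matrix.of p.1) b (c + p.2) (c' + p.2)} +
          ENNReal.ofReal (Real.exp (-(d * Real.log n))) := by
  have hd0 : (0 : ℝ) < d := by positivity
  have hm0 : 0 ≤ m := by
    rw [hm]
    exact div_nonneg (Real.log_nonneg (by norm_num)) (by positivity)
  have hmd : 1 - Real.exp (-(m * (2 * d))) = 1 / 100 := by
    rw [hm, div_mul_cancel₀ _ (by positivity), Real.exp_neg, Real.exp_log (by norm_num)]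
    norm_num
  have hB : MeasurableSet {a : Fin n → Fin d → ℝ | ∃ i, 2 < ‖WithLp.toLp 2 (a i)‖} :=
    measurableSet_setOfPred.2 (Measurable.exists fun i => measurableSet_setOfPred.1
      (measurableSet_lt measurable_const
        ((WithLp.measurable_toLp 2 (Fin d → ℝ)).comp (measurable_pi_apply i)).norm))
  have hP := measurableSet_shadowPath (n := n) b c c' I
  refine (prod_measure_le_of_left_slices (B := {a | ∃ i, 2 < ‖WithLp.toLp 2 (a i)‖}) _ _
    (hP.inter (measurableSet_multiplierBases c c' m I).compl) hP hB (ENNReal.ofReal (1 / 100))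
    fun a ha => ?_).trans (add_le_add le_rfl
      (matrixLaw_long_row_le hn hd hσ hσ' Abar hAbar))
  have ha' : ∀ i, ‖WithLp.toLp 2 (a i)‖ ≤ 2 := fun i => not_lt.1 fun h => ha ⟨i, h⟩
  by_cases hF : I ∈ feasibleBases (Matrix.of a) b
  · have h1 := shiftLaw_multiplierBases_diff_le hf c c' a ha' I hm0
    rw [hmd] at h1
    simpa only [shadowPath_eq, Set.mem_inter_iff, Set.mem_ofPred_eq, Set.mem_compl_iff, hF,
      true_and] using h1
  · simp [shadowPath_eq, hF]

/-- The expected number of bases on the shadow path without gap or without good multipliers. -/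
theorem lintegral_ncard_shadowPath_diff_le (hn : 2 ≤ n) (hd : 1 ≤ d) {σ : ℝ} (hσ : 0 < σ)
    (hσ' : σ ≤ 1 / (4 * √(d * Real.log n))) (Abar : Fin n → Fin d → ℝ)
    (hAbar : ∀ i, ‖WithLp.toLp 2 (Abar i)‖ ≤ 1) (b : Fin n → ℝ)
    (c c' : EuclideanSpace ℝ (Fin d)) {f : EuclideanSpace ℝ (Fin d) → ℝ}
    (hf : IsLogLipschitz 1 f) [IsProbabilityMeasure (shiftLaw f)] {g m : ℝ}
    (hg : g = σ * (1 / (5000 * (d * Real.log n * √(d * Real.log n)))))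
    (hm : m = Real.log (1 / 0.99) / (2 * d)) :
    ∫⁻ p, ((shadowPath (Matrix.of p.1) b (c + p.2) (c' + p.2) \
        (gapBases (Matrix.of p.1) b g ∩
          multiplierBases (Matrix.of p.1) (c + p.2) (c' + p.2) m)).ncard : ℝ≥0∞)
        ∂(matrixLaw (σ ^ 2).toNNReal Abar).prod (shiftLaw f) ≤
      ENNReal.ofReal (11 / 100) *
        ∫⁻ p, ((shadowPath (Matrix.of p.1) b (c + p.2) (c' + p.2)).ncard : ℝ≥0∞)
          ∂(matrixLaw (σ ^ 2).toNNReal Abar).prod (shiftLaw f) + 2 := by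
  have hgap := prod_shadowPath_diff_gapBases_le hn hd hσ Abar b c c' (shiftLaw f) hg
  have hmul := prod_shadowPath_diff_multiplierBases_le hn hd hσ hσ' Abar hAbar b c c' hf hm
  rw [lintegral_ncard _ (measurableSet_shadowPath_diff b c c' g m),
    lintegral_ncard _ (measurableSet_shadowPath b c c')]
  generalize (matrixLaw (σ ^ 2).toNNReal Abar).prod (shiftLaw f) = Q at hgap hmul ⊢
  have hbound : ∀ I : IndexSet n d,
      Q {p | I ∈ shadowPath (Matrix.of p.1) b (c + p.2) (c' + p.2) \
          (gapBases (Matrix.of p.1) b g ∩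
            multiplierBases (Matrix.of p.1) (c + p.2) (c' + p.2) m)} ≤
        ENNReal.ofReal (11 / 100) *
          Q {p | I ∈ shadowPath (Matrix.of p.1) b (c + p.2) (c' + p.2)} +
          2 * ENNReal.ofReal (Real.exp (-(d * Real.log n))) := fun I => by
    have hsub : {p : (Fin n → Fin d → ℝ) × EuclideanSpace ℝ (Fin d) |
        I ∈ shadowPath (Matrix.of p.1) b (c + p.2) (c' + p.2) \
          (gapBases (Matrix.of p.1) b g ∩
            multiplierBases (Matrix.of p.1) (c + p.2) (c' + p.2) m)} ⊆
        {p | I ∈ shadowPath (Matrix.of p.1) b (c + p.2) (c' + p.2) ∧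
          I ∉ gapBases (Matrix.of p.1) b g} ∪
        {p | I ∈ shadowPath (Matrix.of p.1) b (c + p.2) (c' + p.2) ∧
          I ∉ multiplierBases (Matrix.of p.1) (c + p.2) (c' + p.2) m} := by
      rintro p ⟨h1, h2⟩
      by_cases h3 : I ∈ gapBases (Matrix.of p.1) b g
      · exact Or.inr ⟨h1, fun h4 => h2 ⟨h3, h4⟩⟩
      · exact Or.inl ⟨h1, h3⟩
    have h11 : ENNReal.ofReal (11 / 100) =
        ENNReal.ofReal (1 / 10) + ENNReal.ofReal (1 / 100) := by
      rw [← ENNReal.ofReal_add (by norm_num) (by norm_num)]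
      norm_num
    refine (measure_mono hsub).trans ((measure_union_le _ _).trans
      ((add_le_add (hgap I) (hmul I)).trans_eq ?_))
    rw [h11, add_mul, two_mul, add_add_add_comm]
  refine (Finset.sum_le_sum fun I _ => hbound I).trans ?_
  rw [Finset.sum_add_distrib, ← Finset.mul_sum]
  refine add_le_add le_rfl ?_
  -- Each of the at most `n ^ d` bases contributes two errors `n ^ (-d)`, hence the total of `2`.
  rw [Finset.sum_const, Finset.card_univ, nsmul_eq_mul, mul_left_comm, ← ENNReal.ofReal_natCast,
    ← ENNReal.ofReal_mul (Nat.cast_nonneg _)]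
  exact mul_le_of_le_one_right' (ENNReal.ofReal_le_one.2 (card_indexSet_mul_le hn))

/-! ### The joint law -/

theorem map_eq_matrixLaw {Ω : Type*} [MeasurableSpace Ω] {μ : Measure Ω} [IsProbabilityMeasure μ]
    {v : NNReal} {Abar : Fin n → Fin d → ℝ} {A : Ω → Fin n → Fin d → ℝ}
    (hA : ∀ i j, HasLaw (fun ω => A ω i j) (gaussianReal (Abar i j) v) μ)
    (hAindep : iIndepFun (fun (p : Fin n × Fin d) (ω : Ω) => A ω p.1 p.2) μ) :
    μ.map (fun ω (i : Fin n) (j : Fin d) => A ω i j) = matrixLaw v Abar := by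
  have hm : ∀ p : Fin n × Fin d, AEMeasurable (fun ω => A ω p.1 p.2) μ := fun p =>
    (hA p.1 p.2).aemeasurable
  have h1 := (iIndepFun_iff_map_fun_eq_pi_map hm).1 hAindep
  simp only [(hA _ _).map_eq] at h1
  have h2 : μ.map (fun ω (i : Fin n) (j : Fin d) => A ω i j) =
      (μ.map fun ω (p : Fin n × Fin d) => A ω p.1 p.2).map
        (MeasurableEquiv.curry (Fin n) (Fin d) ℝ) := by
    rw [AEMeasurable.map_map_of_aemeasurable (MeasurableEquiv.measurable _).aemeasurable
      (aemeasurable_pi_lambda _ hm)]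
    rfl
  rw [h2, h1, ← Measure.infinitePi_eq_pi,
    Measure.infinitePi_map_curry fun i j => gaussianReal (Abar i j) v, Measure.infinitePi_eq_pi]
  simp only [Measure.infinitePi_eq_pi]
  rfl

/-- Inserting `hKN` into the integrated count gives `E N ≤ 8 + 0.33 E N + E T`. The bound `C` keeps
`E N` finite, so that `0.33 E N` can be subtracted. -/
theorem lintegral_natCast_le_of_ae_le {Ω : Type*} [MeasurableSpace Ω] {μ : Measure Ω}
    [IsProbabilityMeasure μ] (N K T : Ω → ℕ) (C : ℕ) (hK : AEMeasurable (fun ω => (K ω : ℝ≥0∞)) μ)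
    (hC : ∀ ω, N ω ≤ C) (h : ∀ᵐ ω ∂μ, N ω ≤ T ω + 2 + 3 * K ω)
    (hKN : ∫⁻ ω, (K ω : ℝ≥0∞) ∂μ ≤
      ENNReal.ofReal (11 / 100) * ∫⁻ ω, (N ω : ℝ≥0∞) ∂μ + 2) :
    ∫⁻ ω, (N ω : ℝ≥0∞) ∂μ ≤ 500 + 2 * ∫⁻ ω, (T ω : ℝ≥0∞) ∂μ := by
  have hmain : ∫⁻ ω, (N ω : ℝ≥0∞) ∂μ ≤
      2 + 3 * ∫⁻ ω, (K ω : ℝ≥0∞) ∂μ + ∫⁻ ω, (T ω : ℝ≥0∞) ∂μ := by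
    have h1 : 2 + 3 * ∫⁻ ω, (K ω : ℝ≥0∞) ∂μ = ∫⁻ ω, (2 + 3 * (K ω : ℝ≥0∞)) ∂μ := by
      rw [lintegral_add_left measurable_const, lintegral_const_mul'' _ hK, lintegral_const,
        measure_univ, mul_one]
    -- Integrals add as soon as one summand is measurable, so nothing has to be known about `T`.
    have hm : AEMeasurable (fun ω => 2 + 3 * (K ω : ℝ≥0∞)) μ :=
      aemeasurable_const.add (hK.const_mul 3)
    rw [h1, ← lintegral_add_left' hm]
    refine lintegral_mono_ae ?_
    filter_upwards [h] with ω hω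
    have h3 : (N ω : ℝ≥0∞) ≤ ((T ω + 2 + 3 * K ω : ℕ) : ℝ≥0∞) := Nat.cast_le.2 hω
    refine h3.trans_eq ?_
    push_cast
    ring
  have hNfin : ∫⁻ ω, (N ω : ℝ≥0∞) ∂μ ≠ ∞ := by
    refine ne_top_of_le_ne_top (ENNReal.natCast_ne_top C) ?_
    refine (lintegral_mono fun ω => Nat.cast_le.2 (hC ω)).trans_eq ?_
    rw [lintegral_const, measure_univ, mul_one]
  have hKfin : ∫⁻ ω, (K ω : ℝ≥0∞) ∂μ ≠ ∞ := ne_top_of_le_ne_top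
    (ENNReal.add_ne_top.2 ⟨ENNReal.mul_ne_top ENNReal.ofReal_ne_top hNfin, by simp⟩) hKN
  generalize ∫⁻ ω, (N ω : ℝ≥0∞) ∂μ = N at *
  generalize ∫⁻ ω, (K ω : ℝ≥0∞) ∂μ = K at *
  generalize ∫⁻ ω, (T ω : ℝ≥0∞) ∂μ = T at *
  by_cases hT : T = ∞
  · rw [hT, ENNReal.mul_top two_ne_zero, add_top]
    exact le_top
  lift N to NNReal using hNfin with N'
  lift K to NNReal using hKfin with K'
  lift T to NNReal using hT with T'
  rw [ENNReal.ofReal] at hKN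
  norm_cast at hKN hmain ⊢
  rw [← NNReal.coe_le_coe] at hKN hmain ⊢
  push_cast at hKN hmain ⊢
  rw [Real.coe_toNNReal _ (by norm_num)] at hKN
  linarith [T'.2, N'.2, K'.2]

end

end ShadowPath

/-! ### Transfer to the joint law of the matrix and the shift -/

theorem mainTheorem7
    {Ω : Type*} [MeasurableSpace Ω] (μ : Measure Ω) [IsProbabilityMeasure μ]
    (n d : ℕ) (hn : 2 ≤ n) (hd : 1 ≤ d)
    (σ : ℝ) (hσ : 0 < σ) (hσ' : σ ≤ 1 / (4 * Real.sqrt (d * Real.log n)))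
    (Abar : Matrix (Fin n) (Fin d) ℝ)
    (hAbar : ∀ i, ‖(WithLp.toLp 2 (Abar i) : EuclideanSpace ℝ (Fin d))‖ ≤ 1)
    (A : Ω → Matrix (Fin n) (Fin d) ℝ)
    (hA : ∀ i j, HasLaw (fun ω => A ω i j) (gaussianReal (Abar i j) (σ ^ 2).toNNReal) μ)
    (hAindep : iIndepFun (fun (p : Fin n × Fin d) (ω : Ω) => A ω p.1 p.2) μ)
    (b : Fin n → ℝ) (hb : {i | b i = 0}.ncard ≤ d ∨ ∃ i, b i < 0)
    (c c' : EuclideanSpace ℝ (Fin d))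
    (Z : Ω → EuclideanSpace ℝ (Fin d)) (f : EuclideanSpace ℝ (Fin d) → ℝ)
    (hf : ShadowPath.IsLogLipschitz 1 f)
    (hZ : HasLaw Z (volume.withDensity fun z => ENNReal.ofReal (f z)) μ)
    (hAZ : IndepFun (fun (ω : Ω) (p : Fin n × Fin d) => A ω p.1 p.2) Z μ) :
    ∫⁻ ω, ((ShadowPath.shadowPath (A ω) b (c + Z ω) (c' + Z ω)).ncard : ℝ≥0∞) ∂μ ≤
      500 + 2 * ∫⁻ ω, ((ShadowPath.triples (ShadowPath.shadowGraph (A ω) b (c + Z ω) (c' + Z ω))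
        (ShadowPath.gapBases (A ω) b
            (σ / (5000 * (d : ℝ) ^ (3 / 2 : ℝ) * Real.log n ^ (3 / 2 : ℝ))) ∩
          ShadowPath.multiplierBases (A ω) (c + Z ω) (c' + Z ω)
            (Real.log (1 / 0.99) / (2 * d)))).ncard : ℝ≥0∞) ∂μ := by
  have hAmap := ShadowPath.map_eq_matrixLaw (Abar := fun i j => Abar i j) (A := fun ω i j => A ω i j) hA hAindep
  have hZmap : μ.map Z = ShadowPath.shiftLaw f := hZ.map_eq
  have hprobZ : IsProbabilityMeasure (ShadowPath.shiftLaw f) :=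
    hZmap ▸ Measure.isProbabilityMeasure_map hZ.aemeasurable
  have hAm : AEMeasurable (fun ω (i : Fin n) (j : Fin d) => A ω i j) μ :=
    aemeasurable_pi_lambda _ fun i => aemeasurable_pi_lambda _ fun j => (hA i j).aemeasurable
  have hindep : IndepFun (fun ω (i : Fin n) (j : Fin d) => A ω i j) Z μ :=
    hAZ.comp (MeasurableEquiv.curry (Fin n) (Fin d) ℝ).measurable measurable_id
  have hjoint := (indepFun_iff_map_prod_eq_prod_map_map hAm hZ.aemeasurable).1 hindep
  rw [hAmap, hZmap] at hjoint
  have hpair : AEMeasurable (fun ω => ((fun (i : Fin n) (j : Fin d) => A ω i j), Z ω)) μ :=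
    hAm.prodMk hZ.aemeasurable
  obtain ⟨g, hg⟩ : ∃ g, g = σ / (5000 * (d : ℝ) ^ (3 / 2 : ℝ) * Real.log n ^ (3 / 2 : ℝ)) :=
    ⟨_, rfl⟩
  obtain ⟨m, hm⟩ : ∃ m, m = Real.log (1 / 0.99) / (2 * (d : ℝ)) := ⟨_, rfl⟩
  rw [← hg, ← hm]
  -- This is `g = σh` with `h = 1 / (5000 L^{3/2})` and `L = d ln n`, the form required by the
  -- Gaussian estimate.
  have hg' : g = σ * (1 / (5000 * (d * Real.log n * √(d * Real.log n)))) := by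
    have hlog : 0 ≤ Real.log n := Real.log_nonneg (by exact_mod_cast one_le_two.trans hn)
    have h0 : 0 < d * Real.log n := by linarith [ShadowPath.half_le_mul_log hn hd]
    have h1 : (d : ℝ) ^ (3 / 2 : ℝ) * Real.log n ^ (3 / 2 : ℝ) =
        d * Real.log n * √(d * Real.log n) := by
      rw [← Real.mul_rpow (Nat.cast_nonneg d) hlog, Real.sqrt_eq_rpow,
        show (3 / 2 : ℝ) = 1 + 1 / 2 by norm_num, Real.rpow_add h0, Real.rpow_one]
    rw [hg, mul_assoc, h1, mul_one_div]
  have hdiff := ShadowPath.lintegral_ncard_shadowPath_diff_le hn hd hσ hσ' (fun i j => Abar i j)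
    hAbar b c c' hf hg' hm
  have hgen : ∀ᵐ ω ∂μ, ShadowPath.Nondegenerate (A ω) b ∧
      ShadowPath.GenericSegment (A ω) (c + Z ω) (c' + Z ω) := by
    have h1 := ShadowPath.ae_nondegenerate hσ (fun i j => Abar i j) hb
    have h2 := ShadowPath.ae_genericSegment
      (ShadowPath.matrixLaw (σ ^ 2).toNNReal fun i j => Abar i j) f c c'
    rw [← hAmap] at h1
    rw [← hjoint] at h2
    filter_upwards [ae_of_ae_map hAm h1, ae_of_ae_map hpair h2] with ω hω1 hω2
    exact ⟨hω1, hω2⟩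
  have hmeasP := ShadowPath.measurable_ncard
    fun I => ShadowPath.measurableSet_shadowPath (n := n) b c c' I
  have hmeasD := ShadowPath.measurable_ncard
    fun I => ShadowPath.measurableSet_shadowPath_diff (n := n) b c c' g m I
  rw [← hjoint, lintegral_map' hmeasP.aemeasurable hpair,
    lintegral_map' hmeasD.aemeasurable hpair] at hdiff
  change ∫⁻ ω, ((ShadowPath.shadowPath (A ω) b (c + Z ω) (c' + Z ω) \
      (ShadowPath.gapBases (A ω) b g ∩
        ShadowPath.multiplierBases (A ω) (c + Z ω) (c' + Z ω) m)).ncard : ℝ≥0∞) ∂μ ≤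
    ENNReal.ofReal (11 / 100) *
      ∫⁻ ω, ((ShadowPath.shadowPath (A ω) b (c + Z ω) (c' + Z ω)).ncard : ℝ≥0∞) ∂μ + 2 at hdiff
  refine ShadowPath.lintegral_natCast_le_of_ae_le _ _ _ (Nat.card (ShadowPath.IndexSet n d))
    (hmeasD.comp_aemeasurable hpair) (fun ω => Set.ncard_le_card _) ?_ hdiff
  filter_upwards [hgen] with ω hω
  exact ShadowPath.ncard_shadowPath_le hd hω.1 hω.2 _
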